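/- Work in $\mathbb R^2$ with $\hat s(\theta)=(\cos\theta,\sin\theta)$. Fix constants $\eta_0,R,C_\epsilon>0$ and $C_1,C_2,C_3\in\mathbb R$. A *smooth front* $(A,\phi,x_0,\hat d_0)$ consists of a point $x_0$, a unit vector $\hat d_0$, an amplitude $A$ (complex valued, $C^1$ on the disc $D=\{|x-x_0|<R\}$) and a phase $\phi$ (real valued, $C^2$ on $D$), both independent of the frequency $\omega$, with $\nabla\phi(x_0)=\eta_0\hat d_0$ (so $\eta_0=1/c(x_0)$ is the slowness at $x_0$), and with $|\nabla A|\le C_1$, $|A|\le C_2$ and $|s^T\nabla^2\phi\, s|\le C_3$ on $D$ for all unit vectors $s$. For $\omega>0$ put $k=\omega\eta_0$, $r=C_\epsilon\omega^{-1/2}$, $\alpha=kr$, and let $$u=Ae^{i\omega\phi},\qquad u_0(x)=A(x_0)e^{i\omega(\phi(x_0)+\nabla\phi(x_0)\cdot(x-x_0))}$$ be the wave front and its plane wave at $x_0$. The impedance data of a field $v$ on the circle $|x-x_0|=r$ are $\frac1{ik}\partial_r v(x_0+r\hat s(\theta))+v(x_0+r\hat s(\theta))$; write $U$ and $U^{plane}$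 for those of $u$ and $u_0$, and $\delta U=U-U^{plane}$. With $J_l$ the Bessel functions of the first kind, $(\mathcal FU)_l=\frac1{2\pi}\int_0^{2\pi}U(\theta)e^{-il\theta}d\theta$ and $L_\alpha=\max(1,[\alpha],[\alpha+\alpha^{1/3}-2.5])$, the NMLA (numerical microlocal analysis) filter is $$\mathcal BU(\theta)=\frac1{2L_\alpha+1}\sum_{l=-L_\alpha}^{L_\alpha}\frac{(\mathcal FU)_l\,e^{il\theta}}{i^l\,(J_l(\alpha)-iJ_l'(\alpha))},$$ and an NMLA angle is any $\theta^*$ at which $|\mathcal BU|$ attains its maximum over $\mathbb R$; the estimated ray direction is $\hat s(\theta^*)$. (1) There are $K$ and $\omega_1>0$, depending only on $\eta_0,R,C_1,C_2,C_3,C_\epsilon$, such that for every smooth front, all $\omega\ge\omega_1$ and all $\theta$, $$|\delta U(\theta)|\le 2C_\epsilon^2C_3|A(x_0)|+K\omega^{-1/2}.$$ (2) Suppose $2C_\epsilon^2C_3\le\frac14$. Then there is $K$, depending only on the same constants, and for each $a>0$ there is $\omega_2>0$, depending only on $a$ and the same constants, such that for every smooth front with $|A(x_0)|\ge a$ and all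 $\omega\ge\omega_2$: (i) the NMLA noise condition $\|\delta U\|_{L^\infty}<\frac{1}{4B^*}|A(x_0)|$ holds for every constant $0<B^*\le0.89$; (ii) an NMLA angle exists, and every NMLA angle $\theta^*$ satisfies $|\theta_1-\theta^*|\le K\omega^{-1/2}$ for some $\theta_1$ with $\hat d_0=\hat s(\theta_1)$, and $|\hat s(\theta^*)-\hat d_0|\le K\omega^{-1/2}$; that is, the error of the ray direction is $O(\omega^{-1/2})$. -/

import Mathlib

open MeasureTheory
open scoped ENNReal

noncomputable section

namespace RayNMLA

/-- The plane with the Euclidean norm. -/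
abbrev Plane : Type := EuclideanSpace ℝ (Fin 2)

/-- The unit vector `ŝ(θ) = (cos θ, sin θ)`. -/
def dir (θ : ℝ) : Plane := !₂[Real.cos θ, Real.sin θ]

/-- The wave field `A e^{iωφ}`. -/
def waveField (A : Plane → ℂ) (φ : Plane → ℝ) (ω : ℝ) (x : Plane) : ℂ :=
  A x * Complex.exp (Complex.I * ω * φ x)

/-- The linearisation `φ₀(x) = φ(x₀) + ∇φ(x₀) · (x - x₀)` of the phase at `x₀`. -/
def linPhase (φ : Plane → ℝ) (x₀ : Plane) (x : Plane) : ℝ :=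
  φ x₀ + inner ℝ (gradient φ x₀) (x - x₀)

/-- The plane wave `u₀(x) = A(x₀) e^{iωφ₀(x)}`. -/
def planeWave (A : Plane → ℂ) (φ : Plane → ℝ) (x₀ : Plane) (ω : ℝ) : Plane → ℂ :=
  waveField (fun _ => A x₀) (linPhase φ x₀) ω

/-- The impedance quantity `U(θ) = (1/(ik)) ∂_r u(x(θ)) + u(x(θ))`, `x(θ) = x₀ + r ŝ(θ)`,
of a field `u` on the circle of centre `x₀` and radius `r`. -/
def impedance (k r : ℝ) (x₀ : Plane) (u : Plane → ℂ) (θ : ℝ) : ℂ :=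
  1 / (Complex.I * k) * deriv (fun ρ : ℝ => u (x₀ + ρ • dir θ)) r + u (x₀ + r • dir θ)

/-- The deviation `δU = U - U^plane` of the impedance data of the wave front `A e^{iωφ}` from
those of the plane wave at `x₀`; the local wave number is `k = ω η₀`. -/
def deltaU (A : Plane → ℂ) (φ : Plane → ℝ) (x₀ : Plane) (η₀ ω r : ℝ) (θ : ℝ) : ℂ :=
  impedance (ω * η₀) r x₀ (waveField A φ ω) θ - impedance (ω * η₀) r x₀ (planeWave A φ x₀ ω) θ

/-- The Bessel function `J_l` of the first kind and of integer order, by Bessel's integral. -/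
def besselJ (l : ℤ) (x : ℝ) : ℝ :=
  1 / Real.pi * ∫ τ in (0 : ℝ)..Real.pi, Real.cos (l * τ - x * Real.sin τ)

/-- `L_α = max (1, [α], [α + α^{1/3} - 2.5])`. -/
def cutoff (α : ℝ) : ℕ :=
  max 1 (max ⌊α⌋₊ ⌊α + α ^ (1 / 3 : ℝ) - 5 / 2⌋₊)

/-- The filter
`𝓑U(θ) = 1/(2L_α+1) ∑_{|l| ≤ L_α} (𝓕U)_l e^{ilθ} / (i^l (J_l(α) - i J_l'(α)))`,
where `(𝓕U)_l = (1/2π) ∫_0^{2π} U(θ) e^{-ilθ} dθ`. -/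
def nmlaFilter (α : ℝ) (U : ℝ → ℂ) (θ : ℝ) : ℂ :=
  1 / (2 * (cutoff α : ℂ) + 1) * ∑ l ∈ Finset.Icc (-(cutoff α : ℤ)) (cutoff α : ℤ),
    fourierCoeffOn Real.two_pi_pos U l * Complex.exp (Complex.I * l * θ) /
      (Complex.I ^ l * ((besselJ l α : ℂ) - Complex.I * ((deriv (besselJ l) α : ℝ) : ℂ)))

/-- `θs` is an angle returned by NMLA: the modulus of the filtered impedance data of `u`, with
`α = k r`, is maximal there. -/
def IsNMLAAngle (k r : ℝ) (x₀ : Plane) (u : Plane → ℂ) (θs : ℝ) : Prop :=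
  ∀ θ : ℝ, ‖nmlaFilter (k * r) (impedance k r x₀ u) θ‖ ≤
    ‖nmlaFilter (k * r) (impedance k r x₀ u) θs‖

/-- The noise condition `‖δU‖_{L^∞} < |B₁| / (4 B)` for data on the circle, where `B₁` is the complex
amplitude of the plane wave, that is, its value at the centre. -/
def NoiseCondition (B : ℝ) (δU : ℝ → ℂ) (B₁ : ℂ) : Prop :=
  eLpNorm δU ∞ (volume.restrict (Set.Ioc 0 (2 * Real.pi))) < ENNReal.ofReal (‖B₁‖ / (4 * B))

/-- A smooth wave front near `x₀`: amplitude `A` and phase `φ`, independent of the frequency,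
with `∇φ(x₀) = η₀ d₀`, `|d₀| = 1`, where `η₀` is the slowness `1/c(x₀)`, and, on the disc of
centre `x₀` and radius `R`, the bounds `|∇A| ≤ C₁`, `|A| ≤ C₂` and `|sᵀ ∇²φ s| ≤ C₃` for all
unit vectors `s`. -/
structure IsSmoothFront (η₀ R C₁ C₂ C₃ : ℝ) (A : Plane → ℂ) (φ : Plane → ℝ) (x₀ d₀ : Plane) :
    Prop where
  smooth_amplitude : ContDiffOn ℝ 1 A (Metric.ball x₀ R)
  smooth_phase : ContDiffOn ℝ 2 φ (Metric.ball x₀ R)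
  norm_direction : ‖d₀‖ = 1
  gradient_phase : gradient φ x₀ = η₀ • d₀
  gradient_amplitude_le : ∀ x ∈ Metric.ball x₀ R, ‖fderiv ℝ A x‖ ≤ C₁
  amplitude_le : ∀ x ∈ Metric.ball x₀ R, ‖A x‖ ≤ C₂
  curvature_le : ∀ x ∈ Metric.ball x₀ R, ∀ s : Plane, ‖s‖ = 1 →
    |fderiv ℝ (fderiv ℝ φ) x s s| ≤ C₃

end RayNMLA

end

namespace RayNMLA

/-! The circle has radius r = Cε ω^(-1/2), so on it the phase differs from its linearisation by at
most C₃r²/2, and `deltaU` is at most Cε²C₃|A(x₀)| + O(ω^(-1/2)) (`IsSmoothFront.norm_deltaU_le`).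
The leading term does not decay, so the direction is recovered from the stability of the filter, not
from small data errors.

The Fourier coefficients of plane wave data are, up to amplitude and phase e^(-ilθ₁), exactly the
denominators of the filter. The filtered plane wave is therefore its amplitude times a normalised
Dirichlet kernel: 1 at θ₁, and at most 1/((2L+1)|sin((θ-θ₁)/2)|) elsewhere. On the noise,
Cauchy–Schwarz and Bessel's inequality bound the filter by ‖δU‖∞ (∑ 1/(J_l² + J_l'²))^(1/2)/(2L+1).
The sum is at most 41α² for large α (`sum_inv_besselJ_energy_le`), so the filter amplifies noise by
at most 3.25. Noise below 0.13|A(x₀)| stays below 7/16 of the amplitude after filtering. At a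
maximum the kernel is then at least 1/8, which forces |sin((θ*-θ₁)/2)| ≤ 8/α, with α = η₀Cε√ω
(`abs_sin_le_of_isMax`).

The sum needs lower bounds for J_l² + J_l'² at α. For order 0 they come from an explicit integral;
the recurrences carry them to each fixed order at infinity; a monotone corrected adiabatic invariant
brings them back to α when |l| ≤ α - 8α^(1/3). In the remaining window around the turning point |l|
= α a Grönwall argument suffices, as that window holds only O(α^(1/3)) modes. -/

/-! ### Bessel functions: recurrences and the differential equation in Euler form. -/

theorem hasDerivAt_besselJ (l : ℤ) (x : ℝ) :
    HasDerivAt (besselJ l) ((besselJ (l - 1) x - besselJ (l + 1) x) / 2) x := by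
  have h : HasDerivAt (fun y : ℝ => ∫ τ in (0 : ℝ)..Real.pi, Real.cos (l * τ - y * Real.sin τ))
      (∫ τ in (0 : ℝ)..Real.pi, Real.sin τ * Real.sin (l * τ - x * Real.sin τ)) x := by
    refine (intervalIntegral.hasDerivAt_integral_of_dominated_loc_of_deriv_le
      (F := fun (y τ : ℝ) => Real.cos (l * τ - y * Real.sin τ))
      (F' := fun (y τ : ℝ) => Real.sin τ * Real.sin (l * τ - y * Real.sin τ)) (bound := fun _ => 1)
      (s := Set.univ) Filter.univ_mem ?_ ?_ ?_ ?_ ?_ ?_).2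
    · exact Filter.Eventually.of_forall fun y =>
        Continuous.aestronglyMeasurable (by fun_prop)
    · exact Continuous.intervalIntegrable (by fun_prop) _ _
    · exact Continuous.aestronglyMeasurable (by fun_prop)
    · refine Filter.Eventually.of_forall fun τ _ y _ => ?_
      rw [Real.norm_eq_abs, abs_mul]
      exact mul_le_one₀ (Real.abs_sin_le_one _) (abs_nonneg _) (Real.abs_sin_le_one _)
    · exact intervalIntegrable_const
    · refine Filter.Eventually.of_forall fun τ _ y _ => ?_
      have h1 : HasDerivAt (fun y : ℝ => l * τ - y * Real.sin τ) (-(1 * Real.sin τ)) y :=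
        ((hasDerivAt_id y).mul_const (Real.sin τ)).const_sub (l * τ)
      exact h1.cos.congr_deriv (by ring)
  refine (h.const_mul (1 / Real.pi)).congr_deriv ?_
  unfold besselJ
  rw [← mul_sub, ← intervalIntegral.integral_sub
    (Continuous.intervalIntegrable (by fun_prop) _ _)
    (Continuous.intervalIntegrable (by fun_prop) _ _), mul_div_assoc,
    ← intervalIntegral.integral_div]
  congr 1
  refine intervalIntegral.integral_congr fun τ _ => ?_
  have h1 : ((l - 1 : ℤ) : ℝ) * τ - x * Real.sin τ = (l * τ - x * Real.sin τ) - τ := by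
    push_cast; ring
  have h2 : ((l + 1 : ℤ) : ℝ) * τ - x * Real.sin τ = (l * τ - x * Real.sin τ) + τ := by
    push_cast; ring
  simp only [h1, h2, Real.cos_sub _ τ, Real.cos_add _ τ]
  ring

theorem deriv_besselJ (l : ℤ) (x : ℝ) :
    deriv (besselJ l) x = (besselJ (l - 1) x - besselJ (l + 1) x) / 2 :=
  (hasDerivAt_besselJ l x).deriv

theorem continuous_besselJ (l : ℤ) : Continuous (besselJ l) :=
  continuous_iff_continuousAt.2 fun x => (hasDerivAt_besselJ l x).continuousAt

/-- The function sin(lτ - x sin τ) vanishes at 0 and π, so its derivative integrates to zero. -/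
theorem mul_besselJ_add (l : ℤ) (x : ℝ) :
    x * (besselJ (l - 1) x + besselJ (l + 1) x) = 2 * l * besselJ l x := by
  have h : ∫ τ in (0 : ℝ)..Real.pi,
      Real.cos (l * τ - x * Real.sin τ) * (l - x * Real.cos τ) = 0 := by
    rw [intervalIntegral.integral_eq_sub_of_hasDerivAt
      (f := fun τ => Real.sin (l * τ - x * Real.sin τ))]
    · simp
    · intro τ _
      have h1 : HasDerivAt (fun τ : ℝ => l * τ - x * Real.sin τ) (l * 1 - x * Real.cos τ) τ :=
        ((hasDerivAt_id τ).const_mul (l : ℝ)).sub ((Real.hasDerivAt_sin τ).const_mul x)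
      simpa using h1.sin
    · exact Continuous.intervalIntegrable (by fun_prop) _ _
  have h3 : ∀ τ : ℝ, Real.cos (l * τ - x * Real.sin τ) * (l - x * Real.cos τ)
      = l * Real.cos (l * τ - x * Real.sin τ) - x / 2 * (Real.cos ((l - 1 : ℤ) * τ - x * Real.sin τ)
        + Real.cos ((l + 1 : ℤ) * τ - x * Real.sin τ)) := by
    intro τ
    have h1 : ((l - 1 : ℤ) : ℝ) * τ - x * Real.sin τ = (l * τ - x * Real.sin τ) - τ := by
      push_cast; ring
    have h2 : ((l + 1 : ℤ) : ℝ) * τ - x * Real.sin τ = (l * τ - x * Real.sin τ) + τ := by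
      push_cast; ring
    simp only [h1, h2, Real.cos_sub _ τ, Real.cos_add _ τ]
    ring
  simp only [h3] at h
  rw [intervalIntegral.integral_sub (Continuous.intervalIntegrable (by fun_prop) _ _)
    (Continuous.intervalIntegrable (by fun_prop) _ _), intervalIntegral.integral_const_mul,
    intervalIntegral.integral_const_mul, intervalIntegral.integral_add
    (Continuous.intervalIntegrable (by fun_prop) _ _)
    (Continuous.intervalIntegrable (by fun_prop) _ _)] at h
  unfold besselJ
  linear_combination (-(2 / Real.pi)) * h

/-- The Euler derivative `x J_l'(x)`. -/
noncomputable def eulerJ (l : ℤ) (x : ℝ) : ℝ := x * ((besselJ (l - 1) x - besselJ (l + 1) x) / 2)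

theorem eulerJ_eq (l : ℤ) (x : ℝ) : eulerJ l x = x * deriv (besselJ l) x := by
  rw [eulerJ, deriv_besselJ]

theorem eulerJ_eq_sub (l : ℤ) (x : ℝ) :
    eulerJ l x = l * besselJ l x - x * besselJ (l + 1) x := by
  rw [eulerJ]; linear_combination (1 / 2) * mul_besselJ_add l x

theorem eulerJ_eq_sub' (l : ℤ) (x : ℝ) :
    eulerJ l x = x * besselJ (l - 1) x - l * besselJ l x := by
  rw [eulerJ]; linear_combination (-1 / 2) * mul_besselJ_add l x

theorem hasDerivAt_besselJ' (l : ℤ) {x : ℝ} (hx : x ≠ 0) :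
    HasDerivAt (besselJ l) (eulerJ l x / x) x := by
  refine (hasDerivAt_besselJ l x).congr_deriv ?_
  rw [eulerJ]; field_simp

theorem hasDerivAt_eulerJ (l : ℤ) {x : ℝ} (hx : x ≠ 0) :
    HasDerivAt (eulerJ l) (-((x ^ 2 - l ^ 2) * besselJ l x) / x) x := by
  have h1 : eulerJ l = fun x => l * besselJ l x - x * besselJ (l + 1) x :=
    funext (eulerJ_eq_sub l)
  rw [h1]
  refine (((hasDerivAt_besselJ' l hx).const_mul (l : ℝ)).sub
    ((hasDerivAt_id x).mul (hasDerivAt_besselJ' (l + 1) hx))).congr_deriv ?_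
  have h2 := eulerJ_eq_sub' (l + 1) x
  have h3 := eulerJ_eq_sub l x
  simp only [add_sub_cancel_right, Int.cast_add, Int.cast_one] at h2
  simp only [id, h2, h3]
  field_simp
  ring

/-! ### Lower bound for the energy of order zero. -/

theorem besselJ_zero_eq (x : ℝ) :
    besselJ 0 x = 2 / Real.pi * ∫ u in (0 : ℝ)..(Real.pi / 2), Real.cos (x * Real.cos u) := by
  have hc : Continuous fun τ : ℝ => Real.cos (x * Real.sin τ) := by fun_prop
  have h1 : ∫ τ in (0 : ℝ)..(Real.pi / 2), Real.cos (x * Real.sin τ)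
      = ∫ u in (0 : ℝ)..(Real.pi / 2), Real.cos (x * Real.cos u) := by
    have := intervalIntegral.integral_comp_sub_left (a := 0) (b := Real.pi / 2)
      (fun τ => Real.cos (x * Real.sin τ)) (Real.pi / 2)
    simpa [Real.sin_pi_div_two_sub] using this.symm
  have h2 : ∫ τ in (Real.pi / 2)..Real.pi, Real.cos (x * Real.sin τ)
      = ∫ u in (0 : ℝ)..(Real.pi / 2), Real.cos (x * Real.cos u) := by
    have := intervalIntegral.integral_comp_add_right (a := 0) (b := Real.pi / 2)
      (fun τ => Real.cos (x * Real.sin τ)) (Real.pi / 2)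
    simpa [Real.sin_add_pi_div_two] using this.symm
  have h3 := intervalIntegral.integral_add_adjacent_intervals
    (hc.intervalIntegrable 0 (Real.pi / 2)) (hc.intervalIntegrable (μ := volume) (Real.pi / 2) Real.pi)
  unfold besselJ
  simp only [Int.cast_zero, zero_mul, zero_sub, Real.cos_neg]
  rw [← h3, h1, h2]
  ring

theorem mul_integral_sin_mul (x c : ℝ) :
    c * ∫ t in (0 : ℝ)..x, Real.sin (t * c) = 1 - Real.cos (x * c) := by
  rw [intervalIntegral.mul_integral_comp_mul_right]
  simp

theorem integral_sin_mul_nonneg (x : ℝ) {c : ℝ} (hc : 0 ≤ c) :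
    0 ≤ ∫ t in (0 : ℝ)..x, Real.sin (t * c) := by
  rcases hc.eq_or_lt with rfl | hc
  · simp
  · refine (mul_nonneg_iff_of_pos_left hc).1 ?_
    rw [mul_integral_sin_mul]
    linarith [Real.cos_le_one (x * c)]

theorem le_integral_sin_mul {x c z : ℝ} (hx : 0 ≤ x) (hc : 0 ≤ c) (hz : z = x * c / 2)
    (hz6 : z ^ 2 ≤ 6) :
    x * (z - z ^ 3 / 3 + z ^ 5 / 36) ≤ ∫ t in (0 : ℝ)..x, Real.sin (t * c) := by
  rcases hc.eq_or_lt with rfl | hc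
  · simp [hz]
  refine le_of_mul_le_mul_left ?_ hc
  have hz0 : 0 ≤ z := by rw [hz]; positivity
  have h1 := Real.sin_ge_sub_cube hz0
  have h0 : 0 ≤ z - z ^ 3 / 6 := by
    have : 0 ≤ z * (6 - z ^ 2) := mul_nonneg hz0 (by linarith)
    linarith
  have h2 := pow_le_pow_left₀ h0 h1 2
  rw [mul_integral_sin_mul, show x * c = 2 * z by rw [hz]; ring, Real.cos_two_mul, Real.cos_sq']
  calc c * (x * (z - z ^ 3 / 3 + z ^ 5 / 36)) = (x * c) * (z - z ^ 3 / 3 + z ^ 5 / 36) := by ring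
    _ = 2 * (z - z ^ 3 / 6) ^ 2 := by rw [show x * c = 2 * z by rw [hz]; ring]; ring
    _ ≤ _ := by linarith

theorem continuous_eulerJ (l : ℤ) : Continuous (eulerJ l) := by
  have := continuous_besselJ (l - 1)
  have := continuous_besselJ (l + 1)
  unfold eulerJ
  fun_prop

theorem integral_sin_mul_besselJ_zero {x : ℝ} (hx : 0 ≤ x) :
    ∫ t in (0 : ℝ)..x, Real.sin t * besselJ 0 t
      = x * besselJ 0 x * Real.sin x + eulerJ 0 x * Real.cos x := by
  have h0 := continuous_besselJ 0
  have h1 := continuous_eulerJ 0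
  rw [intervalIntegral.integral_eq_sub_of_hasDerivAt_of_le
    (f := fun x => x * besselJ 0 x * Real.sin x + eulerJ 0 x * Real.cos x) hx
    (Continuous.continuousOn (by fun_prop)) (fun t ht => ?_)
    (Continuous.intervalIntegrable (by fun_prop) _ _)]
  · simp [eulerJ]
  · have ht0 : t ≠ 0 := ht.1.ne'
    refine ((((hasDerivAt_id t).mul (hasDerivAt_besselJ' 0 ht0)).mul (Real.hasDerivAt_sin t)).add
      ((hasDerivAt_eulerJ 0 ht0).mul (Real.hasDerivAt_cos t))).congr_deriv ?_
    simp only [Pi.mul_apply, id, Int.cast_zero]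
    field_simp
    ring

/-- In the integral formula for J₀, sin t cos(t cos u) is half the sum of sin(t(1 - cos u)) and
sin(t(1 + cos u)). After exchanging the integrals, each inner integral has the form (1 - cos(xc))/c
≥ 0, and the one with 1 + cos u is dropped. -/
theorem integral_sin_mul_besselJ_zero_ge (x : ℝ) :
    1 / Real.pi * ∫ u in (0 : ℝ)..(Real.pi / 2), ∫ t in (0 : ℝ)..x, Real.sin (t * (1 - Real.cos u))
      ≤ ∫ t in (0 : ℝ)..x, Real.sin t * besselJ 0 t := by
  have hpi := Real.pi_pos
  have hcont : Continuous fun u => ∫ t in (0 : ℝ)..x, Real.sin (t * (1 - Real.cos u)) :=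
    intervalIntegral.continuous_parametric_intervalIntegral_of_continuous' (by fun_prop) _ _
  have h1 : ∫ t in (0 : ℝ)..x, Real.sin t * besselJ 0 t = 1 / Real.pi *
      ∫ t in (0 : ℝ)..x, ∫ u in (0 : ℝ)..(Real.pi / 2),
        (Real.sin (t * (1 - Real.cos u)) + Real.sin (t * (1 + Real.cos u))) := by
    rw [← intervalIntegral.integral_const_mul]
    refine intervalIntegral.integral_congr fun t _ => ?_
    simp only [besselJ_zero_eq]
    rw [← intervalIntegral.integral_const_mul, ← intervalIntegral.integral_const_mul,
      ← intervalIntegral.integral_const_mul]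
    refine intervalIntegral.integral_congr fun u _ => ?_
    simp only [mul_add, mul_sub, mul_one, Real.sin_add, Real.sin_sub]
    ring
  rw [h1, intervalIntegral_intervalIntegral_swap (a := 0) (b := x)]
  · refine mul_le_mul_of_nonneg_left ?_ (by positivity)
    refine intervalIntegral.integral_mono_on (by positivity) (hcont.intervalIntegrable _ _) ?_ ?_
    · refine Continuous.intervalIntegrable ?_ _ _
      exact intervalIntegral.continuous_parametric_intervalIntegral_of_continuous'
        (by fun_prop) _ _
    · intro u hu
      rw [intervalIntegral.integral_add (Continuous.intervalIntegrable (by fun_prop) _ _)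
        (Continuous.intervalIntegrable (by fun_prop) _ _)]
      have := integral_sin_mul_nonneg x (c := 1 + Real.cos u)
        (by linarith [Real.neg_one_le_cos u])
      linarith
  · refine IntegrableOn.mono_set (t := Set.uIcc 0 x ×ˢ Set.uIcc 0 (Real.pi / 2)) ?_
      (Set.prod_mono Set.uIoc_subset_uIcc Set.uIoc_subset_uIcc)
    exact ContinuousOn.integrableOn_compact (isCompact_uIcc.prod isCompact_uIcc)
      (Continuous.continuousOn (by fun_prop))

theorem le_integral_integral_sin {x : ℝ} (hx : 9 / 2 ≤ x) :
    1.059 * √x ≤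
      ∫ u in (0 : ℝ)..(Real.pi / 2), ∫ t in (0 : ℝ)..x, Real.sin (t * (1 - Real.cos u)) := by
  have hx0 : 0 ≤ x := by linarith
  have hpi := Real.pi_pos
  have hcont : Continuous fun u => ∫ t in (0 : ℝ)..x, Real.sin (t * (1 - Real.cos u)) :=
    intervalIntegral.continuous_parametric_intervalIntegral_of_continuous' (by fun_prop) _ _
  have hs0 : 0 < √x := Real.sqrt_pos.2 (by linarith)
  have hs : √x ^ 2 = x := Real.sq_sqrt hx0
  -- The u-integral is cut where w = 2√x sin(u/2) reaches 3. The hypothesis 9/2 ≤ x puts this point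
  -- below π/2, and z = w²/4 ≤ 9/4 keeps z² ≤ 6 there.
  obtain ⟨v, hv0, hv1, hv⟩ : ∃ v : ℝ, 0 ≤ v ∧ v ≤ Real.pi / 2 ∧ 2 * √x * Real.sin (v / 2) = 3 := by
    have h1 : 3 / (2 * √x) ≤ √2 / 2 := by
      rw [div_le_div_iff₀ (by positivity) (by norm_num)]
      have : 3 ≤ √2 * √x := by
        rw [← Real.sqrt_mul (by norm_num)]
        exact Real.le_sqrt_of_sq_le (by linarith)
      linarith
    obtain ⟨v, hv, hv'⟩ := intermediate_value_Icc (a := 0) (b := Real.pi / 4) (by positivity)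
      Real.continuous_sin.continuousOn (show 3 / (2 * √x) ∈ Set.Icc _ _ by
        rw [Real.sin_zero, Real.sin_pi_div_four]; exact ⟨by positivity, h1⟩)
    refine ⟨2 * v, by linarith [hv.1], by linarith [hv.2], ?_⟩
    rw [mul_div_cancel_left₀ _ two_ne_zero, hv']
    field_simp
  set w : ℝ → ℝ := fun u => 2 * √x * Real.sin (u / 2) with hw
  have hwd : ∀ u, HasDerivAt w (√x * Real.cos (u / 2)) u := fun u =>
    ((((hasDerivAt_id u).div_const 2).sin).const_mul (2 * √x)).congr_deriv (by simp; ring)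
  -- The factor cos(u/2) ≤ 1 turns the polynomial lower bound into an exact derivative, since w' =
  -- √x cos(u/2).
  have hint : ∫ u in (0 : ℝ)..v, x * (w u ^ 2 / 4 - w u ^ 6 / 192 + w u ^ 10 / 36864)
      * Real.cos (u / 2) = √x * (3 ^ 3 / 12 - 3 ^ 7 / 1344 + 3 ^ 11 / 405504) := by
    rw [intervalIntegral.integral_eq_sub_of_hasDerivAt
      (f := fun u => √x * (w u ^ 3 / 12 - w u ^ 7 / 1344 + w u ^ 11 / 405504))]
    · simp only [hw] at hv ⊢
      simp [hv]
    · intro u _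
      refine ((((((hwd u).pow 3).div_const 12).sub (((hwd u).pow 7).div_const 1344)).add
        (((hwd u).pow 11).div_const 405504)).const_mul (√x)).congr_deriv ?_
      rw [show x * (w u ^ 2 / 4 - w u ^ 6 / 192 + w u ^ 10 / 36864)
        = √x ^ 2 * (w u ^ 2 / 4 - w u ^ 6 / 192 + w u ^ 10 / 36864) by rw [hs]]
      push_cast
      ring
    · exact Continuous.intervalIntegrable (by simp only [hw]; fun_prop) _ _
  have hmono : ∫ u in (0 : ℝ)..v, x * (w u ^ 2 / 4 - w u ^ 6 / 192 + w u ^ 10 / 36864)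
      * Real.cos (u / 2) ≤ ∫ u in (0 : ℝ)..v, ∫ t in (0 : ℝ)..x,
        Real.sin (t * (1 - Real.cos u)) := by
    refine intervalIntegral.integral_mono_on hv0
      (Continuous.intervalIntegrable (by simp only [hw]; fun_prop) _ _)
      (hcont.intervalIntegrable _ _) fun u hu => ?_
    have hsin0 : 0 ≤ Real.sin (u / 2) :=
      Real.sin_nonneg_of_nonneg_of_le_pi (by linarith [hu.1]) (by linarith [hu.2])
    have hw0 : 0 ≤ w u := by simp only [hw]; positivity
    have hw3 : w u ≤ 3 := by
      rw [← hv]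
      refine mul_le_mul_of_nonneg_left (Real.sin_le_sin_of_le_of_le_pi_div_two ?_ ?_ ?_)
        (by positivity) <;> linarith [hu.1, hu.2]
    have hcos : 1 - Real.cos u = 2 * Real.sin (u / 2) ^ 2 := by
      have := Real.cos_two_mul (u / 2)
      rw [Real.cos_sq', mul_div_cancel₀ _ two_ne_zero] at this
      linarith
    have hz : w u ^ 2 / 4 = x * (1 - Real.cos u) / 2 := by
      rw [hcos]; simp only [hw]; rw [mul_pow, mul_pow, hs]; ring
    have hw9 : w u ^ 2 ≤ 9 := by nlinarith
    have hz2 : w u ^ 2 / 4 ≤ 9 / 4 := by linarith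
    have hzz : 0 ≤ w u ^ 2 / 4 := by positivity
    have h6 : (w u ^ 2 / 4) ^ 2 ≤ 6 := by nlinarith
    have h1 := le_integral_sin_mul hx0 (by linarith [Real.cos_le_one u]) hz h6
    refine le_trans ?_ h1
    have hP : 0 ≤ x * (w u ^ 2 / 4 - (w u ^ 2 / 4) ^ 3 / 3 + (w u ^ 2 / 4) ^ 5 / 36) := by
      have : w u ^ 2 / 4 - (w u ^ 2 / 4) ^ 3 / 3 + (w u ^ 2 / 4) ^ 5 / 36
        = w u ^ 2 / 4 * (1 - (w u ^ 2 / 4) ^ 2 / 6) ^ 2 := by ring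
      rw [this]; positivity
    calc _ = x * (w u ^ 2 / 4 - (w u ^ 2 / 4) ^ 3 / 3 + (w u ^ 2 / 4) ^ 5 / 36)
            * Real.cos (u / 2) := by ring
      _ ≤ _ := mul_le_of_le_one_right hP (Real.cos_le_one _)
  have hsplit := intervalIntegral.integral_add_adjacent_intervals
    (hcont.intervalIntegrable 0 v) (hcont.intervalIntegrable (μ := volume) v (Real.pi / 2))
  have hrest : 0 ≤ ∫ u in v..(Real.pi / 2), ∫ t in (0 : ℝ)..x,
      Real.sin (t * (1 - Real.cos u)) :=
    intervalIntegral.integral_nonneg hv1 fun u _ =>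
      integral_sin_mul_nonneg x (by linarith [Real.cos_le_one u])
  have hnum : 1.059 * √x ≤ √x * (3 ^ 3 / 12 - 3 ^ 7 / 1344 + 3 ^ 11 / 405504) := by
    rw [mul_comm]
    exact mul_le_mul_of_nonneg_left (by norm_num) hs0.le
  linarith

/-- The explicit antiderivative is x times the inner product of (J₀, J₀') with the unit vector (sin
x, cos x), so Cauchy–Schwarz turns its lower bound 0.337√x into one for the energy; 0.337² > 0.11.
-/
theorem besselJ_zero_energy {x : ℝ} (hx : 9 / 2 ≤ x) :
    0.11 ≤ x * (besselJ 0 x ^ 2 + deriv (besselJ 0) x ^ 2) := by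
  have hx0 : 0 < x := by linarith
  have hpi := Real.pi_pos
  have h1 := integral_sin_mul_besselJ_zero_ge x
  have h2 := le_integral_integral_sin hx
  rw [integral_sin_mul_besselJ_zero hx0.le, eulerJ_eq] at h1
  set p := besselJ 0 x
  set q := deriv (besselJ 0) x
  have hs0 : 0 < √x := Real.sqrt_pos.2 hx0
  have hs : √x ^ 2 = x := Real.sq_sqrt hx0.le
  have h3 : 1 / Real.pi * (1.059 * √x) ≤ x * p * Real.sin x + x * q * Real.cos x :=
    le_trans (mul_le_mul_of_nonneg_left h2 (by positivity)) h1
  have h4 : 0.337 ≤ 1 / Real.pi * 1.059 := by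
    rw [div_mul_eq_mul_div, le_div_iff₀ hpi]
    nlinarith [Real.pi_lt_d4]
  have h5 : 0.337 * √x ≤ x * p * Real.sin x + x * q * Real.cos x := by
    nlinarith
  have h6 : (0.337 * √x) ^ 2 ≤ (x * p * Real.sin x + x * q * Real.cos x) ^ 2 :=
    pow_le_pow_left₀ (by positivity) h5 2
  have h7 : (x * p * Real.sin x + x * q * Real.cos x) ^ 2 ≤ x ^ 2 * (p ^ 2 + q ^ 2) := by
    have : x ^ 2 * (p ^ 2 + q ^ 2) = (x * p * Real.sin x + x * q * Real.cos x) ^ 2 +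
      (x * p * Real.cos x - x * q * Real.sin x) ^ 2 := by
      linear_combination (-(x ^ 2 * (p ^ 2 + q ^ 2))) * Real.sin_sq_add_cos_sq x
    rw [this]
    exact le_add_of_nonneg_right (sq_nonneg _)
  rw [mul_pow, hs] at h6
  refine le_of_mul_le_mul_left ?_ hx0
  nlinarith

/-! ### Transfer of the energy bound to every fixed order at infinity. -/

/-- The map (p, q) ↦ (P, Q) is a coordinate swap up to two shears of size at most δ. Raising or
lowering the order of a Bessel function by one has this form, with shears l/x and (l+1)/x. -/
theorem sq_add_sq_perturb {p q s t δ P Q : ℝ} (hs : |s| ≤ δ) (ht : |t| ≤ δ) (hδ : δ ≤ 1)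
    (hP : P = q + s * p) (hQ : Q = p + t * P) :
    (1 - 4 * δ) * (p ^ 2 + q ^ 2) ≤ P ^ 2 + Q ^ 2 := by
  have hδ0 : 0 ≤ δ := (abs_nonneg s).trans hs
  have h1 : |s * (2 * (p * q))| ≤ δ * (p ^ 2 + q ^ 2) := by
    rw [abs_mul]
    refine mul_le_mul hs ?_ (abs_nonneg _) hδ0
    rw [abs_le]; constructor <;> nlinarith [sq_nonneg (p - q), sq_nonneg (p + q)]
  have h2 : |t * (2 * (p * P))| ≤ δ * (p ^ 2 + P ^ 2) := by
    rw [abs_mul]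
    refine mul_le_mul ht ?_ (abs_nonneg _) hδ0
    rw [abs_le]; constructor <;> nlinarith [sq_nonneg (p - P), sq_nonneg (p + P)]
  have hs1 : s ^ 2 ≤ 1 := by
    rw [← sq_abs]; exact pow_le_one₀ (abs_nonneg s) (hs.trans hδ)
  have h3 : P ^ 2 ≤ 2 * (p ^ 2 + q ^ 2) := by
    rw [hP]; nlinarith [sq_nonneg (q - s * p), sq_nonneg p]
  have h4 : q ^ 2 - δ * (p ^ 2 + q ^ 2) ≤ P ^ 2 := by
    rw [hP]; nlinarith [(abs_le.1 h1).1, sq_nonneg (s * p)]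
  have h5 : p ^ 2 - δ * (p ^ 2 + P ^ 2) ≤ Q ^ 2 := by
    rw [hQ]; nlinarith [(abs_le.1 h2).1, sq_nonneg (t * P)]
  have h6 : δ * P ^ 2 ≤ δ * (2 * (p ^ 2 + q ^ 2)) := mul_le_mul_of_nonneg_left h3 hδ0
  nlinarith [mul_nonneg hδ0 (sq_nonneg q)]

theorem deriv_besselJ_eq_sub (l : ℤ) {x : ℝ} (hx : x ≠ 0) :
    deriv (besselJ l) x = l / x * besselJ l x - besselJ (l + 1) x := by
  have := eulerJ_eq_sub l x
  rw [eulerJ_eq] at this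
  field_simp
  linarith

theorem deriv_besselJ_succ (l : ℤ) {x : ℝ} (hx : x ≠ 0) :
    deriv (besselJ (l + 1)) x = besselJ l x - (l + 1) / x * besselJ (l + 1) x := by
  have := eulerJ_eq_sub' (l + 1) x
  rw [eulerJ_eq] at this
  push_cast at this
  rw [add_sub_cancel_right] at this
  field_simp
  linarith

theorem besselJ_energy_succ (l : ℤ) {x δ : ℝ} (hx : 0 < x) (hδ : δ ≤ 1)
    (hl : (|(l : ℝ)| + 1) / x ≤ δ) :
    (1 - 4 * δ) * (besselJ l x ^ 2 + deriv (besselJ l) x ^ 2)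
        ≤ besselJ (l + 1) x ^ 2 + deriv (besselJ (l + 1)) x ^ 2 ∧
    (1 - 4 * δ) * (besselJ (l + 1) x ^ 2 + deriv (besselJ (l + 1)) x ^ 2)
        ≤ besselJ l x ^ 2 + deriv (besselJ l) x ^ 2 := by
  have h1 : |(l : ℝ) / x| ≤ δ := by
    rw [abs_div, abs_of_pos hx]
    exact le_trans (by gcongr; linarith) hl
  have h2 : |((l : ℝ) + 1) / x| ≤ δ := by
    rw [abs_div, abs_of_pos hx]
    refine le_trans (by gcongr; exact (abs_add_le _ _).trans (by simp)) hl
  have e1 := deriv_besselJ_eq_sub l hx.ne'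
  have e2 := deriv_besselJ_succ l hx.ne'
  constructor
  · have := sq_add_sq_perturb (p := besselJ l x) (q := deriv (besselJ l) x)
      (P := -besselJ (l + 1) x) (Q := deriv (besselJ (l + 1)) x) (s := -((l : ℝ) / x))
      (t := ((l : ℝ) + 1) / x) (by rwa [abs_neg]) h2 hδ (by rw [e1]; ring) (by rw [e2]; ring)
    rwa [neg_sq] at this
  · have := sq_add_sq_perturb (p := besselJ (l + 1) x) (q := deriv (besselJ (l + 1)) x)
      (P := besselJ l x) (Q := -deriv (besselJ l) x) (s := ((l : ℝ) + 1) / x)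
      (t := -((l : ℝ) / x)) h2 (by rwa [abs_neg]) hδ (by rw [e2]; ring) (by rw [e1]; ring)
    rwa [neg_sq] at this

/-- Each change of order costs a factor tending to 1 as x grows. Quantifying over all c < 0.11 makes
the claim stable under induction on l in both directions. -/
theorem eventually_besselJ_energy (l : ℤ) : ∀ c < (0.11 : ℝ), ∀ᶠ x : ℝ in Filter.atTop,
    c ≤ x * (besselJ l x ^ 2 + deriv (besselJ l) x ^ 2) := by
  have step : ∀ (l m : ℤ) (B : ℝ), (∀ x δ : ℝ, 0 < x → δ ≤ 1 → B / x ≤ δ →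
      (1 - 4 * δ) * (besselJ l x ^ 2 + deriv (besselJ l) x ^ 2)
        ≤ besselJ m x ^ 2 + deriv (besselJ m) x ^ 2) →
      (∀ c < (0.11 : ℝ), ∀ᶠ x : ℝ in Filter.atTop,
        c ≤ x * (besselJ l x ^ 2 + deriv (besselJ l) x ^ 2)) →
      ∀ c < (0.11 : ℝ), ∀ᶠ x : ℝ in Filter.atTop,
        c ≤ x * (besselJ m x ^ 2 + deriv (besselJ m) x ^ 2) := by
    intro l m B h ih c hc
    obtain ⟨d, hcd, hd⟩ := exists_between (max_lt hc (by norm_num : (0 : ℝ) < 0.11))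
    have hd0 : 0 < d := (le_max_right _ _).trans_lt hcd
    have ht : Filter.Tendsto (fun x : ℝ => B / x) Filter.atTop (nhds 0) :=
      Filter.Tendsto.const_div_atTop Filter.tendsto_id B
    have ht' : Filter.Tendsto (fun x : ℝ => (1 - 4 * (B / x)) * d) Filter.atTop (nhds d) := by
      have := ((ht.const_mul 4).const_sub 1).mul_const d
      simpa using this
    filter_upwards [ih d hd, ht'.eventually_const_le ((le_max_left _ _).trans_lt hcd),
      ht.eventually_le_const (by norm_num : (0 : ℝ) < 1 / 4), Filter.eventually_gt_atTop 0]
      with x h1 h2 h3 h4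
    have h5 := h x (B / x) h4 (by linarith) le_rfl
    calc c ≤ (1 - 4 * (B / x)) * d := h2
      _ ≤ (1 - 4 * (B / x)) * (x * (besselJ l x ^ 2 + deriv (besselJ l) x ^ 2)) :=
          mul_le_mul_of_nonneg_left h1 (by linarith)
      _ = x * ((1 - 4 * (B / x)) * (besselJ l x ^ 2 + deriv (besselJ l) x ^ 2)) := by ring
      _ ≤ _ := mul_le_mul_of_nonneg_left h5 h4.le
  induction l using Int.induction_on with
  | zero =>
    intro c hc
    filter_upwards [Filter.eventually_ge_atTop (9 / 2)] with x hx
    exact hc.le.trans (besselJ_zero_energy hx)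
  | succ i ih => exact step _ _ _ (fun x δ hx hδ h => (besselJ_energy_succ i hx hδ h).1) ih
  | pred i ih =>
    refine step _ _ (|((-(i : ℤ) - 1 : ℤ) : ℝ)| + 1) (fun x δ hx hδ h => ?_) ih
    have := (besselJ_energy_succ (-(i : ℤ) - 1) hx hδ h).2
    rwa [sub_add_cancel] at this

/-! ### The adiabatic invariant and its almost-monotonicity. -/

/-- `√(x² - l²)`, the local frequency of `J_l` in the variable `log x`. -/
noncomputable def localFreq (l : ℤ) (x : ℝ) : ℝ := √(x ^ 2 - l ^ 2)

/-- The adiabatic invariant of Bessel's equation. -/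
noncomputable def wkbEnergy (l : ℤ) (x : ℝ) : ℝ :=
  localFreq l x * besselJ l x ^ 2 + eulerJ l x ^ 2 / localFreq l x

/-- The adiabatic parameter: the relative rate of change of the local frequency. -/
noncomputable def wkbParam (l : ℤ) (x : ℝ) : ℝ := x ^ 2 / localFreq l x ^ 3

theorem localFreq_pos {l : ℤ} {x : ℝ} (h : |(l : ℝ)| < x) : 0 < localFreq l x :=
  Real.sqrt_pos.2 (sub_pos.2 (sq_lt_sq.2 (h.trans_le (le_abs_self x))))

theorem localFreq_sq {l : ℤ} {x : ℝ} (h : |(l : ℝ)| < x) : localFreq l x ^ 2 = x ^ 2 - l ^ 2 :=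
  Real.sq_sqrt (sub_nonneg.2 (sq_le_sq.2 (h.le.trans (le_abs_self x))))

theorem hasDerivAt_localFreq {l : ℤ} {x : ℝ} (h : |(l : ℝ)| < x) :
    HasDerivAt (localFreq l) (x / localFreq l x) x := by
  have h0 : x ^ 2 - (l : ℝ) ^ 2 ≠ 0 := by rw [← localFreq_sq h]; exact (pow_pos (localFreq_pos h) 2).ne'
  refine ((((hasDerivAt_id x).pow 2).sub_const ((l : ℝ) ^ 2)).sqrt h0).congr_deriv ?_
  have := localFreq_pos h
  simp only [localFreq] at *
  simp only [id, Pi.pow_apply]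
  field_simp
  norm_num

theorem wkbParam_nonneg {l : ℤ} {x : ℝ} (h : |(l : ℝ)| < x) : 0 ≤ wkbParam l x :=
  div_nonneg (sq_nonneg x) (pow_pos (localFreq_pos h) 3).le

theorem hasDerivAt_wkbParam {l : ℤ} {x : ℝ} (h : |(l : ℝ)| < x) :
    HasDerivAt (wkbParam l) (-(x * (x ^ 2 + 2 * l ^ 2)) / localFreq l x ^ 5) x := by
  have hs := localFreq_pos h
  refine (((hasDerivAt_id x).pow 2).div ((hasDerivAt_localFreq h).pow 3)
    (pow_pos hs 3).ne').congr_deriv ?_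
  have h2 : (l : ℝ) ^ 2 = x ^ 2 - localFreq l x ^ 2 := by rw [localFreq_sq h]; ring
  rw [h2]
  simp only [id, Pi.pow_apply]
  field_simp
  push_cast
  ring

theorem wkbParam_antitone {l : ℤ} {x y : ℝ} (h : |(l : ℝ)| < x) (hxy : x ≤ y) :
    wkbParam l y ≤ wkbParam l x := by
  have hd : ∀ z ∈ Set.Ici x, |(l : ℝ)| < z := fun z hz => h.trans_le hz
  refine antitoneOn_of_hasDerivWithinAt_nonpos (convex_Ici x)
    (f' := fun z => -(z * (z ^ 2 + 2 * l ^ 2)) / localFreq l z ^ 5)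
    (fun z hz => (hasDerivAt_wkbParam (hd z hz)).continuousAt.continuousWithinAt)
    (fun z hz => (hasDerivAt_wkbParam (hd z (interior_subset hz))).hasDerivWithinAt)
    (fun z hz => ?_) Set.self_mem_Ici hxy hxy
  have hz := hd z (interior_subset hz)
  have hz0 : 0 < z := (abs_nonneg _).trans_lt hz
  have := localFreq_pos hz
  rw [neg_div]
  exact neg_nonpos.2 (by positivity)

/-- In t = log x Bessel's equation is an oscillator of frequency s = `localFreq`, and the energy
changes at rate p(s²J² - (dJ/dt)²) with p = `wkbParam`. This is -p times the rate of J dJ/dt, so the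
correction leaves only a term with the derivative of p. -/
theorem hasDerivAt_wkbEnergy_add {l : ℤ} {x : ℝ} (h : |(l : ℝ)| < x) :
    HasDerivAt (fun y => wkbEnergy l y + wkbParam l y * (besselJ l y * eulerJ l y))
      (-(x * (x ^ 2 + 2 * l ^ 2)) / localFreq l x ^ 5 * (besselJ l x * eulerJ l x)) x := by
  have hs := localFreq_pos h
  have hx : x ≠ 0 := ((abs_nonneg _).trans_lt h).ne'
  have hJ := hasDerivAt_besselJ' l hx
  have hK := hasDerivAt_eulerJ l hx
  have hS := hasDerivAt_localFreq h
  refine (((hS.mul (hJ.pow 2)).add ((hK.pow 2).div hS hs.ne')).add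
    ((hasDerivAt_wkbParam h).mul (hJ.mul hK))).congr_deriv ?_
  simp only [Pi.pow_apply, Pi.mul_apply, wkbParam, ← localFreq_sq h]
  field_simp
  push_cast
  ring

theorem wkbEnergy_add_eq {l : ℤ} {x : ℝ} (h : |(l : ℝ)| < x) (ε : ℝ) (hε : ε ^ 2 = 1) :
    wkbEnergy l x + 2 * ε * (besselJ l x * eulerJ l x)
      = (localFreq l x * besselJ l x + ε * eulerJ l x) ^ 2 / localFreq l x := by
  have hs := localFreq_pos h
  rw [wkbEnergy]
  field_simp
  linear_combination (-(eulerJ l x ^ 2)) * hε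

/-- With V the corrected energy, the derivative of V/(2 - p) is p' times a square over positive
factors, and p decreases. The quotient is therefore antitone, and |2 J dJ/dt| ≤ `wkbEnergy` compares
V with the energy at both ends. -/
theorem wkbEnergy_le {l : ℤ} {x y : ℝ} (h : |(l : ℝ)| < x) (hp : wkbParam l x < 2) (hxy : x ≤ y) :
    wkbEnergy l y * (2 - wkbParam l x) ≤ wkbEnergy l x * (2 + wkbParam l x) := by
  have hd : ∀ z ∈ Set.Ici x, |(l : ℝ)| < z := fun z hz => h.trans_le hz
  have hp2 : ∀ z ∈ Set.Ici x, 0 < 2 - wkbParam l z := fun z hz => by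
    linarith [wkbParam_antitone h hz]
  set V : ℝ → ℝ := fun y => wkbEnergy l y + wkbParam l y * (besselJ l y * eulerJ l y) with hV
  have hD : ∀ z ∈ Set.Ici x, HasDerivAt (fun y => V y / (2 - wkbParam l y))
      (-(z * (z ^ 2 + 2 * l ^ 2)) / localFreq l z ^ 5 *
        ((localFreq l z * besselJ l z + eulerJ l z) ^ 2 / localFreq l z) /
          (2 - wkbParam l z) ^ 2) z := by
    intro z hz
    refine ((hasDerivAt_wkbEnergy_add (hd z hz)).div
      ((hasDerivAt_wkbParam (hd z hz)).const_sub 2) (hp2 z hz).ne').congr_deriv ?_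
    have := wkbEnergy_add_eq (hd z hz) 1 (by norm_num)
    rw [one_mul] at this
    rw [← this]
    ring
  have hanti : V y / (2 - wkbParam l y) ≤ V x / (2 - wkbParam l x) := by
    refine antitoneOn_of_hasDerivWithinAt_nonpos (convex_Ici x)
      (fun z hz => (hD z hz).continuousAt.continuousWithinAt)
      (fun z hz => (hD z (interior_subset hz)).hasDerivWithinAt)
      (fun z hz => ?_) Set.self_mem_Ici hxy hxy
    have hz' := hd z (interior_subset hz)
    have hz0 : 0 < z := (abs_nonneg _).trans_lt hz'
    have := localFreq_pos hz'
    rw [neg_div, neg_mul, neg_div]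
    exact neg_nonpos.2 (by positivity)
  have hW : ∀ z ∈ Set.Ici x, 0 ≤ wkbEnergy l z + 2 * (besselJ l z * eulerJ l z) ∧
      0 ≤ wkbEnergy l z - 2 * (besselJ l z * eulerJ l z) := by
    intro z hz
    have h1 := wkbEnergy_add_eq (hd z hz) 1 (by norm_num)
    have h2 := wkbEnergy_add_eq (hd z hz) (-1) (by norm_num)
    have h0 := localFreq_pos (hd z hz)
    constructor
    · have : 0 ≤ wkbEnergy l z + 2 * 1 * (besselJ l z * eulerJ l z) := by rw [h1]; positivity
      linarith
    · have : 0 ≤ wkbEnergy l z + 2 * -1 * (besselJ l z * eulerJ l z) := by rw [h2]; positivity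
      linarith
  have hlow : wkbEnergy l y / 2 ≤ V y / (2 - wkbParam l y) := by
    rw [le_div_iff₀ (hp2 y hxy)]
    have := mul_nonneg (wkbParam_nonneg (hd y hxy)) (hW y hxy).1
    simp only [hV]
    linarith
  have hupp : V x ≤ wkbEnergy l x * (2 + wkbParam l x) / 2 := by
    have := mul_nonneg (wkbParam_nonneg h) (hW x Set.self_mem_Ici).2
    simp only [hV]
    linarith
  have h3 := hlow.trans hanti
  rw [le_div_iff₀ (hp2 x Set.self_mem_Ici)] at h3
  linarith

theorem localFreq_mul_energy_le {l : ℤ} {x : ℝ} (h : |(l : ℝ)| < x) :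
    localFreq l x * (besselJ l x ^ 2 + deriv (besselJ l) x ^ 2) ≤ wkbEnergy l x := by
  have hs := localFreq_pos h
  rw [wkbEnergy, eulerJ_eq, mul_add]
  refine add_le_add le_rfl ?_
  rw [le_div_iff₀ hs, mul_pow]
  have h1 : localFreq l x ^ 2 ≤ x ^ 2 := by rw [localFreq_sq h]; linarith [sq_nonneg (l : ℝ)]
  nlinarith [mul_le_mul_of_nonneg_right h1 (sq_nonneg (deriv (besselJ l) x))]

theorem wkbEnergy_mul_localFreq_le {l : ℤ} {x : ℝ} (h : |(l : ℝ)| < x) :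
    wkbEnergy l x * localFreq l x ≤ x ^ 2 * (besselJ l x ^ 2 + deriv (besselJ l) x ^ 2) := by
  have hs := localFreq_pos h
  have : wkbEnergy l x * localFreq l x
      = localFreq l x ^ 2 * besselJ l x ^ 2 + x ^ 2 * deriv (besselJ l) x ^ 2 := by
    rw [wkbEnergy, eulerJ_eq]; field_simp
  rw [this, localFreq_sq h]
  nlinarith [mul_nonneg (sq_nonneg (l : ℝ)) (sq_nonneg (besselJ l x))]

theorem eventually_le_wkbEnergy (l : ℤ) {c : ℝ} (hc : c < 0.11) :
    ∀ᶠ x : ℝ in Filter.atTop, c ≤ wkbEnergy l x := by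
  obtain ⟨d, hcd, hd⟩ := exists_between (max_lt hc (by norm_num : (0 : ℝ) < 0.11))
  have hd0 : 0 < d := (le_max_right _ _).trans_lt hcd
  have ht : Filter.Tendsto (fun x : ℝ => √(1 - (l / x) ^ 2) * d) Filter.atTop (nhds d) := by
    have h1 : Filter.Tendsto (fun x : ℝ => (l : ℝ) / x) Filter.atTop (nhds 0) :=
      Filter.Tendsto.const_div_atTop Filter.tendsto_id (l : ℝ)
    have h2 := (((h1.pow 2).const_sub 1).sqrt).mul_const d
    simpa using h2
  filter_upwards [eventually_besselJ_energy l d hd,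
    ht.eventually_const_le ((le_max_left _ _).trans_lt hcd),
    Filter.eventually_gt_atTop |(l : ℝ)|] with x h1 h2 h3
  have hx0 : 0 < x := (abs_nonneg _).trans_lt h3
  have h4 : localFreq l x = √(1 - (l / x) ^ 2) * x := by
    have h5 : √((1 - (l / x) ^ 2) * x ^ 2) = √(1 - (l / x) ^ 2) * x := by
      rw [Real.sqrt_mul' _ (sq_nonneg x), Real.sqrt_sq hx0.le]
    rw [← h5, localFreq]
    congr 1
    field_simp
  calc c ≤ √(1 - (l / x) ^ 2) * d := h2
    _ ≤ √(1 - (l / x) ^ 2) * (x * (besselJ l x ^ 2 + deriv (besselJ l) x ^ 2)) :=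
        mul_le_mul_of_nonneg_left h1 (Real.sqrt_nonneg _)
    _ = localFreq l x * (besselJ l x ^ 2 + deriv (besselJ l) x ^ 2) := by rw [h4]; ring
    _ ≤ _ := localFreq_mul_energy_le h3

/-- The energy at x is compared with the energy at a far point y, where it exceeds any c < 0.11; c =
0.109 leaves room for the ratio (2 - p)/(2 + p). -/
theorem wkbEnergy_ge {l : ℤ} {x : ℝ} (h : |(l : ℝ)| < x) (hp : wkbParam l x ≤ 1 / 20) :
    0.1 ≤ wkbEnergy l x := by
  have h1 : ∀ c < (0.11 : ℝ), c * (2 - wkbParam l x) ≤ wkbEnergy l x * (2 + wkbParam l x) := by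
    intro c hc
    obtain ⟨y, h2, h3⟩ := ((eventually_le_wkbEnergy l hc).and
      (Filter.eventually_ge_atTop x)).exists
    exact (mul_le_mul_of_nonneg_right h2 (by linarith)).trans
      (wkbEnergy_le h (by linarith) h3)
  have h2 := h1 0.109 (by norm_num)
  have h3 := wkbParam_nonneg h
  by_contra! h4
  nlinarith

theorem besselJ_energy_ge {l : ℤ} {x : ℝ} (h : |(l : ℝ)| < x) (hp : wkbParam l x ≤ 1 / 20) :
    0.1 * localFreq l x / x ^ 2 ≤ besselJ l x ^ 2 + deriv (besselJ l) x ^ 2 := by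
  have hx0 : 0 < x := (abs_nonneg _).trans_lt h
  rw [div_le_iff₀ (by positivity), mul_comm _ (x ^ 2)]
  exact (mul_le_mul_of_nonneg_right (wkbEnergy_ge h hp) (localFreq_pos h).le).trans
    (wkbEnergy_mul_localFreq_le h)

/-! ### Energy bounds at x = a³, below the turning point and near it. -/

theorem besselJ_energy_ge_of_le {l : ℤ} {a : ℝ} (ha : 0 < a) (hl : |(l : ℝ)| ≤ a ^ 3 - 8 * a) :
    0.1 * √(a ^ 3 * (a ^ 3 - |(l : ℝ)|)) / (a ^ 3) ^ 2 ≤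
      besselJ l (a ^ 3) ^ 2 + deriv (besselJ l) (a ^ 3) ^ 2 := by
  have h : |(l : ℝ)| < a ^ 3 := by linarith
  have hs := localFreq_pos h
  have hs2 := localFreq_sq h
  have h1 : a ^ 3 * (a ^ 3 - |(l : ℝ)|) ≤ (a ^ 3) ^ 2 - (l : ℝ) ^ 2 := by
    rw [← sq_abs (l : ℝ)]; nlinarith [abs_nonneg (l : ℝ)]
  have h2 : √(a ^ 3 * (a ^ 3 - |(l : ℝ)|)) ≤ localFreq l (a ^ 3) := Real.sqrt_le_sqrt h1
  -- The margin 8a gives s² ≥ 8a⁴, and 2.8³ > 20 puts the adiabatic parameter under 1/20.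
  have h3 : 2.8 * a ^ 2 ≤ localFreq l (a ^ 3) := by
    refine le_of_sq_le_sq ?_ hs.le
    rw [hs2]
    have : a ^ 3 * (8 * a) ≤ a ^ 3 * (a ^ 3 - |(l : ℝ)|) :=
      mul_le_mul_of_nonneg_left (by linarith) (by positivity)
    nlinarith [pow_pos ha 4]
  have h4 : wkbParam l (a ^ 3) ≤ 1 / 20 := by
    rw [wkbParam, div_le_div_iff₀ (by positivity) (by norm_num)]
    have := pow_le_pow_left₀ (by positivity) h3 3
    nlinarith [pow_pos ha 6]
  refine le_trans ?_ (besselJ_energy_ge h h4)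
  gcongr

/-- At y = a³ + 10a every such order is already oscillatory, and the adiabatic bound applies. Going
back to a³ over a length 10a, the rescaled energy G has logarithmic derivative at most 41/a in
absolute value, hence the loss e^(-410). -/
theorem besselJ_energy_ge_of_near {l : ℤ} {a : ℝ} (ha : 10 ≤ a) (hl : a ^ 3 - 8 * a ≤ |(l : ℝ)|)
    (hl' : |(l : ℝ)| ≤ a ^ 3 + a) :
    Real.exp (-410) / (70 * a ^ 4) ≤
      besselJ l (a ^ 3) ^ 2 + deriv (besselJ l) (a ^ 3) ^ 2 := by
  have ha0 : 0 < a := by linarith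
  set y := a ^ 3 + 10 * a with hy
  have h : |(l : ℝ)| < y := by linarith
  have ha3 : 100 * a ≤ a ^ 3 := by nlinarith [mul_nonneg ha0.le (sub_nonneg.2 ha)]
  have hya : y ≤ 1.1 * a ^ 3 := by linarith
  have hs := localFreq_pos h
  have hs2 := localFreq_sq h
  have hl0 := abs_nonneg (l : ℝ)
  have hQ : ∀ x ∈ Set.Icc (a ^ 3) y, |x ^ 2 - (l : ℝ) ^ 2| ≤ 40 * a ^ 4 := by
    intro x hx
    have e : x ^ 2 - (l : ℝ) ^ 2 = (x - |(l : ℝ)|) * (x + |(l : ℝ)|) := by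
      rw [← sq_abs (l : ℝ)]; ring
    have e1 : |(x - |(l : ℝ)|)| ≤ 18 * a := abs_le.2 ⟨by linarith [hx.1], by linarith [hx.2]⟩
    have e2 : |(x + |(l : ℝ)|)| ≤ 2.2 * a ^ 3 := abs_le.2
      ⟨by linarith [hx.1, pow_pos ha0 3], by linarith [hx.2]⟩
    rw [e, abs_mul]
    calc _ ≤ (18 * a) * (2.2 * a ^ 3) := mul_le_mul e1 e2 (abs_nonneg _) (by positivity)
      _ ≤ _ := by nlinarith [pow_pos ha0 4]
  have hs_lo : 3 * a ^ 2 ≤ localFreq l y := by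
    refine le_of_sq_le_sq ?_ hs.le
    rw [hs2, ← sq_abs (l : ℝ)]
    have e1 : 9 * a ≤ y - |(l : ℝ)| := by linarith
    have e2 : a ^ 3 ≤ y + |(l : ℝ)| := by linarith
    have := mul_le_mul e1 e2 (by positivity) (by linarith)
    nlinarith
  have hs_hi : localFreq l y ≤ 7 * a ^ 2 := by
    refine le_of_sq_le_sq ?_ (by positivity)
    rw [hs2]
    nlinarith [(abs_le.1 (hQ y ⟨by linarith, le_rfl⟩)).2, pow_pos ha0 4]
  have hp : wkbParam l y ≤ 1 / 20 := by
    rw [wkbParam, div_le_div_iff₀ (by positivity) (by norm_num)]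
    have e1 := pow_le_pow_left₀ (by positivity) hs_lo 3
    have e2 := pow_le_pow_left₀ (by positivity) hya 2
    nlinarith [pow_pos ha0 6]
  have hW := wkbEnergy_ge h hp
  set G : ℝ → ℝ := fun x => a ^ 2 * besselJ l x ^ 2 + eulerJ l x ^ 2 / a ^ 2 with hG
  have hGy : 1 / 70 ≤ G y := by
    have e1 : localFreq l y * besselJ l y ^ 2 ≤ 7 * a ^ 2 * besselJ l y ^ 2 :=
      mul_le_mul_of_nonneg_right hs_hi (sq_nonneg _)
    have e2 : eulerJ l y ^ 2 / localFreq l y ≤ 7 * (eulerJ l y ^ 2 / a ^ 2) := by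
      rw [div_le_iff₀ hs]
      have : 0 ≤ eulerJ l y ^ 2 / a ^ 2 := by positivity
      calc eulerJ l y ^ 2 = eulerJ l y ^ 2 / a ^ 2 * a ^ 2 := by field_simp
        _ ≤ eulerJ l y ^ 2 / a ^ 2 * (7 * localFreq l y) :=
            mul_le_mul_of_nonneg_left (by nlinarith) this
        _ = _ := by ring
    rw [wkbEnergy] at hW
    simp only [hG]
    linarith
  have hmono : G y * Real.exp (-(41 / a * y)) ≤ G (a ^ 3) * Real.exp (-(41 / a * a ^ 3)) := by
    have hpos : ∀ x ∈ Set.Icc (a ^ 3) y, 0 < x := fun x hx => (pow_pos ha0 3).trans_le hx.1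
    have hD : ∀ x ∈ Set.Icc (a ^ 3) y, HasDerivAt (fun x => G x * Real.exp (-(41 / a * x)))
        (((a ^ 2 - (x ^ 2 - l ^ 2) / a ^ 2) / x * (2 * (besselJ l x * eulerJ l x))
          - 41 / a * G x) * Real.exp (-(41 / a * x))) x := by
      intro x hx
      have hx0 := (hpos x hx).ne'
      have hJ := hasDerivAt_besselJ' l hx0
      have hK := hasDerivAt_eulerJ l hx0
      refine ((((hJ.pow 2).const_mul (a ^ 2)).add ((hK.pow 2).div_const (a ^ 2))).mul
        (((hasDerivAt_id x).const_mul (41 / a)).neg.exp)).congr_deriv ?_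
      simp only [hG, id, Pi.add_apply, Pi.neg_apply, Pi.pow_apply]
      field_simp
      push_cast
      ring
    refine antitoneOn_of_hasDerivWithinAt_nonpos (convex_Icc (a ^ 3) y)
      (fun z hz => (hD z hz).continuousAt.continuousWithinAt)
      (fun z hz => (hD z (interior_subset hz)).hasDerivWithinAt)
      (fun z hz => ?_) (Set.left_mem_Icc.2 (by linarith)) (Set.right_mem_Icc.2 (by linarith))
      (by linarith)
    have hz' := interior_subset hz
    refine mul_nonpos_of_nonpos_of_nonneg ?_ (Real.exp_pos _).le
    rw [sub_nonpos]
    refine (le_abs_self _).trans ?_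
    rw [abs_mul]
    refine mul_le_mul ?_ ?_ (abs_nonneg _) (by positivity)
    · rw [abs_div, abs_of_pos (hpos z hz'), div_le_div_iff₀ (hpos z hz') ha0]
      have e1 : |(z ^ 2 - (l : ℝ) ^ 2) / a ^ 2| ≤ 40 * a ^ 2 := by
        rw [abs_div, abs_of_pos (by positivity : (0 : ℝ) < a ^ 2), div_le_iff₀ (by positivity)]
        linarith [hQ z hz']
      have e2 : |a ^ 2 - (z ^ 2 - (l : ℝ) ^ 2) / a ^ 2| ≤ 41 * a ^ 2 := by
        refine (abs_sub _ _).trans ?_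
        rw [abs_of_pos (by positivity : (0 : ℝ) < a ^ 2)]
        linarith
      nlinarith [hz'.1]
    · have e1 : 0 ≤ (a * besselJ l z - eulerJ l z / a) ^ 2 := sq_nonneg _
      have e2 : 0 ≤ (a * besselJ l z + eulerJ l z / a) ^ 2 := sq_nonneg _
      have e3 : (a * besselJ l z - eulerJ l z / a) ^ 2
        = G z - 2 * (besselJ l z * eulerJ l z) := by simp only [hG]; field_simp; ring
      have e4 : (a * besselJ l z + eulerJ l z / a) ^ 2
        = G z + 2 * (besselJ l z * eulerJ l z) := by simp only [hG]; field_simp; ring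
      exact abs_le.2 ⟨by linarith, by linarith⟩
  have hexp : Real.exp (-(41 / a * y)) = Real.exp (-410) * Real.exp (-(41 / a * a ^ 3)) := by
    rw [← Real.exp_add]
    congr 1
    rw [hy]
    field_simp
    ring
  rw [hexp, ← mul_assoc] at hmono
  have h1 := le_of_mul_le_mul_right hmono (Real.exp_pos _)
  -- Enlarging a² to a⁴ on the J² term is affordable: only O(a) modes fall in this window,
  -- contributing O(a⁵) to a sum of size a⁶.
  have h2 : G (a ^ 3) ≤ a ^ 4 * (besselJ l (a ^ 3) ^ 2 + deriv (besselJ l) (a ^ 3) ^ 2) := by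
    have e : G (a ^ 3) = a ^ 2 * besselJ l (a ^ 3) ^ 2 + a ^ 4 * deriv (besselJ l) (a ^ 3) ^ 2 := by
      simp only [hG, eulerJ_eq]; field_simp
    have : a ^ 2 ≤ a ^ 4 := pow_le_pow_right₀ (by linarith) (by norm_num)
    rw [e, mul_add]
    gcongr
  have h3 : Real.exp (-410) * (1 / 70) ≤ Real.exp (-410) * G y :=
    mul_le_mul_of_nonneg_left hGy (Real.exp_pos _).le
  rw [div_le_iff₀ (by positivity)]
  nlinarith

/-! ### The sum of the inverse energies. -/

theorem inv_sqrt_le_telescope {y : ℝ} (hy : 1 ≤ y) : 1 / √y ≤ 2 * (√y - √(y - 1)) := by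
  have h0 : 0 < √y := Real.sqrt_pos.2 (by linarith)
  have h1 := Real.sq_sqrt (by linarith : 0 ≤ y)
  have h2 := Real.sq_sqrt (by linarith : 0 ≤ y - 1)
  rw [div_le_iff₀ h0]
  nlinarith [sq_nonneg (√y - √(y - 1))]

theorem cutoff_cast_le {a : ℝ} (ha : 1 ≤ a) : (cutoff (a ^ 3) : ℝ) ≤ a ^ 3 + a := by
  have ha3 : 1 ≤ a ^ 3 := one_le_pow₀ ha
  have h : (a ^ 3) ^ (1 / 3 : ℝ) = a := by
    rw [← Real.rpow_natCast, ← Real.rpow_mul (by linarith)]; norm_num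
  rw [cutoff, h]
  push_cast
  refine max_le (by linarith) (max_le ((Nat.floor_le (by linarith)).trans (by linarith)) ?_)
  rcases le_total 0 (a ^ 3 + a - 5 / 2) with h0 | h0
  · exact (Nat.floor_le h0).trans (by linarith)
  · rw [Nat.floor_of_nonpos h0]; simp; linarith

theorem lt_cutoff_add_one (α : ℝ) : α < cutoff α + 1 := by
  refine (Nat.lt_floor_add_one α).trans_le ?_
  have : ⌊α⌋₊ ≤ cutoff α := (le_max_left _ _).trans (le_max_right _ _)
  gcongr

/-- The bound is written as increments in |l| so that the sum over modes telescopes. Both increments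
are nonnegative (square roots of negative numbers are 0), so each regime can discard the other's. -/
theorem inv_besselJ_energy_le {l : ℤ} {a : ℝ} (ha : 10 ≤ a) (hl : |(l : ℝ)| ≤ a ^ 3 + a) :
    0 < besselJ l (a ^ 3) ^ 2 + deriv (besselJ l) (a ^ 3) ^ 2 ∧
    (besselJ l (a ^ 3) ^ 2 + deriv (besselJ l) (a ^ 3) ^ 2)⁻¹ ≤
      20 * (a ^ 3 * √(a ^ 3)) * (√(a ^ 3 - |(l : ℝ)|) - √(a ^ 3 - (|(l : ℝ)| + 1))) +
      70 * Real.exp 410 * a ^ 4 *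
        (max (|(l : ℝ)| + 1 - (a ^ 3 - 8 * a)) 0 - max (|(l : ℝ)| - (a ^ 3 - 8 * a)) 0) := by
  have ha0 : 0 < a := by linarith
  have hE := Real.exp_pos 410
  have hsq : √(a ^ 3 - (|(l : ℝ)| + 1)) ≤ √(a ^ 3 - |(l : ℝ)|) := Real.sqrt_le_sqrt (by linarith)
  have hmax : max (|(l : ℝ)| - (a ^ 3 - 8 * a)) 0 ≤ max (|(l : ℝ)| + 1 - (a ^ 3 - 8 * a)) 0 :=
    max_le_max (by linarith) le_rfl
  have n1 : 0 ≤ 20 * (a ^ 3 * √(a ^ 3)) * (√(a ^ 3 - |(l : ℝ)|) - √(a ^ 3 - (|(l : ℝ)| + 1))) :=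
    mul_nonneg (by positivity) (sub_nonneg.2 hsq)
  have n2 : 0 ≤ 70 * Real.exp 410 * a ^ 4 *
        (max (|(l : ℝ)| + 1 - (a ^ 3 - 8 * a)) 0 - max (|(l : ℝ)| - (a ^ 3 - 8 * a)) 0) :=
    mul_nonneg (by positivity) (sub_nonneg.2 hmax)
  rcases le_total |(l : ℝ)| (a ^ 3 - 8 * a) with h | h
  · have h1 := besselJ_energy_ge_of_le ha0 h
    have hy : 1 ≤ a ^ 3 - |(l : ℝ)| := by linarith
    have hs : 0 < √(a ^ 3 - |(l : ℝ)|) := Real.sqrt_pos.2 (by linarith)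
    have hs3 : 0 < √(a ^ 3) := Real.sqrt_pos.2 (by positivity)
    rw [Real.sqrt_mul (by positivity)] at h1
    have hpos : 0 < 0.1 * (√(a ^ 3) * √(a ^ 3 - |(l : ℝ)|)) / (a ^ 3) ^ 2 := by positivity
    refine ⟨hpos.trans_le h1, (inv_anti₀ hpos h1).trans ?_⟩
    have h2 := inv_sqrt_le_telescope hy
    rw [show a ^ 3 - |(l : ℝ)| - 1 = a ^ 3 - (|(l : ℝ)| + 1) by ring] at h2
    have h3 : (0.1 * (√(a ^ 3) * √(a ^ 3 - |(l : ℝ)|)) / (a ^ 3) ^ 2)⁻¹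
        = 10 * (a ^ 3 * √(a ^ 3)) * (1 / √(a ^ 3 - |(l : ℝ)|)) := by
      have hq : (a ^ 3) ^ 2 = a ^ 3 * √(a ^ 3) ^ 2 := by
        rw [Real.sq_sqrt (by positivity)]; ring
      rw [hq]
      field_simp
      norm_num
    rw [h3]
    have h4 := mul_le_mul_of_nonneg_left h2 (by positivity : 0 ≤ 10 * (a ^ 3 * √(a ^ 3)))
    linarith
  · have h1 := besselJ_energy_ge_of_near ha h hl
    have hpos : 0 < Real.exp (-410) / (70 * a ^ 4) := by positivity
    refine ⟨hpos.trans_le h1, (inv_anti₀ hpos h1).trans ?_⟩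
    rw [max_eq_left (by linarith), max_eq_left (by linarith)]
    have h3 : (Real.exp (-410) / (70 * a ^ 4))⁻¹ = 70 * Real.exp 410 * a ^ 4 *
        (|(l : ℝ)| + 1 - (a ^ 3 - 8 * a) - (|(l : ℝ)| - (a ^ 3 - 8 * a))) := by
      rw [Real.exp_neg]; field_simp; ring
    rw [h3]
    linarith

theorem sum_inv_besselJ_energy_le {a : ℝ} (ha : 10 ≤ a) (ha' : 1400 * Real.exp 410 ≤ a) :
    ∑ l ∈ Finset.Icc (-(cutoff (a ^ 3) : ℤ)) (cutoff (a ^ 3) : ℤ),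
      (besselJ l (a ^ 3) ^ 2 + deriv (besselJ l) (a ^ 3) ^ 2)⁻¹ ≤ 41 * (a ^ 3) ^ 2 := by
  have ha0 : 0 < a := by linarith
  have hE := Real.exp_pos 410
  set N := cutoff (a ^ 3) with hN
  have hNle : (N : ℝ) ≤ a ^ 3 + a := cutoff_cast_le (by linarith)
  set F : ℝ → ℝ := fun n => 20 * (a ^ 3 * √(a ^ 3)) * √(a ^ 3 - n) with hF
  set H : ℝ → ℝ := fun n => 70 * Real.exp 410 * a ^ 4 * max (n - (a ^ 3 - 8 * a)) 0 with hH
  set f : ℝ → ℝ := fun n => F n - F (n + 1) + (H (n + 1) - H n) with hf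
  have hterm : ∀ l ∈ Finset.Icc (-(N : ℤ)) (N : ℤ),
      (besselJ l (a ^ 3) ^ 2 + deriv (besselJ l) (a ^ 3) ^ 2)⁻¹ ≤ f |(l : ℝ)| := by
    intro l hl
    rw [Finset.mem_Icc] at hl
    have : |(l : ℝ)| ≤ N := by exact_mod_cast abs_le.2 hl
    refine (inv_besselJ_energy_le ha (this.trans hNle)).2.trans (le_of_eq ?_)
    simp only [hf, hF, hH]
    ring
  refine (Finset.sum_le_sum hterm).trans ?_
  have heven : Function.Even fun l : ℤ => f |(l : ℝ)| := fun l => by simp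
  have hf0 : 0 ≤ f 0 := by
    refine le_trans ?_ (hterm 0 (by simp))|>.trans_eq (by simp)
    positivity
  have hsum : ∑ n ∈ Finset.range (N + 1), f (n : ℝ) ≤ 20 * (a ^ 3) ^ 2
      + 70 * Real.exp 410 * a ^ 4 * (9 * a + 1) := by
    have e1 : ∑ n ∈ Finset.range (N + 1), f (n : ℝ)
        = (F 0 - F ((N + 1 : ℕ) : ℝ)) + (H ((N + 1 : ℕ) : ℝ) - H 0) := by
      have e2 := Finset.sum_range_sub' (fun n : ℕ => F n) (N + 1)
      have e3 := Finset.sum_range_sub (fun n : ℕ => H n) (N + 1)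
      push_cast at e2 e3 ⊢
      rw [← e2, ← e3, ← Finset.sum_add_distrib]
    have e4 : 0 ≤ F ((N + 1 : ℕ) : ℝ) := by simp only [hF]; positivity
    have e5 : 0 ≤ H 0 := by simp only [hH]; positivity
    have e6 : F 0 = 20 * (a ^ 3) ^ 2 := by
      simp only [hF, sub_zero]
      rw [mul_assoc, mul_assoc, Real.mul_self_sqrt (by positivity)]; ring
    have e7 : H ((N + 1 : ℕ) : ℝ) ≤ 70 * Real.exp 410 * a ^ 4 * (9 * a + 1) := by
      simp only [hH]
      refine mul_le_mul_of_nonneg_left (max_le ?_ (by linarith)) (by positivity)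
      push_cast
      linarith
    linarith
  have h2 := Finset.sum_Icc_of_even_eq_range heven N
  simp only [Int.cast_natCast, Nat.abs_cast, Int.cast_zero, abs_zero, nsmul_eq_mul] at h2
  rw [h2]
  have h3 : 140 * Real.exp 410 * a ^ 4 * (9 * a + 1) ≤ 1400 * Real.exp 410 * a ^ 5 := by
    have : 9 * a + 1 ≤ 10 * a := by linarith
    calc _ ≤ 140 * Real.exp 410 * a ^ 4 * (10 * a) :=
          mul_le_mul_of_nonneg_left this (by positivity)
      _ = _ := by ring
  -- Both signs of l give 40a⁶ from the oscillatory modes; the size of a makes the window contribute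
  -- at most one more a⁶.
  have h4 : 1400 * Real.exp 410 * a ^ 5 ≤ a * a ^ 5 := mul_le_mul_of_nonneg_right ha' (by positivity)
  push_cast
  nlinarith

/-! ### Fourier coefficients of plane wave data. -/

theorem integral_exp_eq_besselJ (l : ℤ) (x : ℝ) :
    ∫ τ in (-Real.pi)..Real.pi, Complex.exp (Complex.I * (x * Real.sin τ - l * τ : ℝ))
      = 2 * Real.pi * besselJ l x := by
  have hc : Continuous fun τ : ℝ => Complex.exp (Complex.I * (x * Real.sin τ - l * τ : ℝ)) := by
    fun_prop
  rw [← intervalIntegral.integral_add_adjacent_intervals (hc.intervalIntegrable (-Real.pi) 0)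
    (hc.intervalIntegrable (μ := volume) 0 Real.pi)]
  have h1 := intervalIntegral.integral_comp_neg (a := 0) (b := Real.pi)
    (fun τ : ℝ => Complex.exp (Complex.I * (x * Real.sin τ - l * τ : ℝ)))
  rw [neg_zero] at h1
  rw [← h1, ← intervalIntegral.integral_add (Continuous.intervalIntegrable (by fun_prop) _ _)
    (hc.intervalIntegrable _ _)]
  have h2 : ∀ τ : ℝ, Complex.exp (Complex.I * (x * Real.sin (-τ) - l * (-τ) : ℝ))
      + Complex.exp (Complex.I * (x * Real.sin τ - l * τ : ℝ))
      = ((2 * Real.cos (l * τ - x * Real.sin τ) : ℝ) : ℂ) := by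
    intro τ
    rw [Complex.ofReal_mul, Complex.ofReal_cos, Complex.ofReal_ofNat, Complex.two_cos]
    congr 2
    · rw [Real.sin_neg]; push_cast; ring
    · push_cast; ring
  simp only [h2]
  rw [intervalIntegral.integral_ofReal, intervalIntegral.integral_const_mul, besselJ]
  have := Real.pi_ne_zero
  push_cast
  field_simp

theorem exp_I_mul_int_mul_pi_div_two (l : ℤ) :
    Complex.exp (Complex.I * (l * (Real.pi / 2) : ℝ)) = Complex.I ^ l := by
  have h : Complex.exp (l * (Real.pi / 2 * Complex.I)) = Complex.I ^ l := by
    rw [Complex.exp_int_mul, Complex.exp_pi_div_two_mul_I]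
  rw [← h]
  congr 1
  push_cast
  ring

theorem exp_I_mul_sub_two_pi (l : ℤ) (y : ℝ) :
    Complex.exp (Complex.I * (y - l * (2 * Real.pi) : ℝ)) = Complex.exp (Complex.I * y) := by
  rw [← Complex.exp_periodic.sub_int_mul_eq l (x := Complex.I * y)]
  congr 1
  push_cast
  ring

theorem integral_exp_cos_eq_besselJ (l : ℤ) (x : ℝ) :
    ∫ ψ in (0 : ℝ)..(2 * Real.pi), Complex.exp (Complex.I * (x * Real.cos ψ - l * ψ : ℝ))
      = 2 * Real.pi * (Complex.I ^ l * besselJ l x) := by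
  have hp : Function.Periodic
      (fun ψ : ℝ => Complex.exp (Complex.I * (x * Real.cos ψ - l * ψ : ℝ))) (2 * Real.pi) := by
    intro ψ
    simp only
    rw [Real.cos_add_two_pi, ← exp_I_mul_sub_two_pi l (x * Real.cos ψ - l * ψ)]
    congr 3
    ring
  have h1 := hp.intervalIntegral_add_eq 0 (-Real.pi - Real.pi / 2)
  rw [zero_add, show -Real.pi - Real.pi / 2 + 2 * Real.pi = Real.pi - Real.pi / 2 by ring] at h1
  rw [h1, ← intervalIntegral.integral_comp_sub_right
    (fun ψ : ℝ => Complex.exp (Complex.I * (x * Real.cos ψ - l * ψ : ℝ))) (Real.pi / 2)]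
  have h2 : ∀ τ : ℝ, Complex.exp (Complex.I * (x * Real.cos (τ - Real.pi / 2)
        - l * (τ - Real.pi / 2) : ℝ))
      = Complex.I ^ l * Complex.exp (Complex.I * (x * Real.sin τ - l * τ : ℝ)) := by
    intro τ
    rw [← exp_I_mul_int_mul_pi_div_two, ← Complex.exp_add, Real.cos_sub_pi_div_two]
    congr 1
    push_cast
    ring
  simp only [h2]
  rw [intervalIntegral.integral_const_mul, integral_exp_eq_besselJ]
  ring

theorem fourierCoeffOn_eq_integral_exp (f : ℝ → ℂ) (l : ℤ) :
    fourierCoeffOn Real.two_pi_pos f l =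
      1 / (2 * Real.pi) * ∫ θ in (0 : ℝ)..(2 * Real.pi),
        Complex.exp (-(Complex.I * (l * θ : ℝ))) * f θ := by
  rw [fourierCoeffOn_eq_integral, sub_zero, Complex.real_smul]
  push_cast
  congr 1
  refine intervalIntegral.integral_congr fun θ _ => ?_
  simp only [fourier_coe_apply, smul_eq_mul]
  congr 2
  have := Real.pi_ne_zero
  push_cast
  field_simp

/-- Impedance data, up to the factor `B`, of a plane wave of direction `θ₁`. -/
noncomputable def planeData (α θ₁ θ : ℝ) : ℂ :=
  (1 + Real.cos (θ - θ₁) : ℝ) * Complex.exp (Complex.I * (α * Real.cos (θ - θ₁) : ℝ))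

theorem continuous_planeData (α θ₁ : ℝ) : Continuous (planeData α θ₁) := by
  unfold planeData
  fun_prop

/-- The factor cos θ averages the coefficients of orders l - 1 and l + 1. Their powers of i combine
to -i · i^l (J_{l-1} - J_{l+1})/2 = -i · i^l J_l'. -/
theorem integral_exp_mul_planeData_zero (l : ℤ) (α : ℝ) :
    ∫ θ in (0 : ℝ)..(2 * Real.pi), Complex.exp (-(Complex.I * (l * θ : ℝ))) * planeData α 0 θ
      = 2 * Real.pi * (Complex.I ^ l *
        (besselJ l α - Complex.I * ((deriv (besselJ l) α : ℝ) : ℂ))) := by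
  have h1 : ∀ θ : ℝ, Complex.exp (-(Complex.I * (l * θ : ℝ))) * planeData α 0 θ
      = Complex.exp (Complex.I * (α * Real.cos θ - l * θ : ℝ)) + 1 / 2 *
        (Complex.exp (Complex.I * (α * Real.cos θ - (l - 1 : ℤ) * θ : ℝ))
        + Complex.exp (Complex.I * (α * Real.cos θ - (l + 1 : ℤ) * θ : ℝ))) := by
    intro θ
    have e1 : Complex.exp (Complex.I * (α * Real.cos θ - (l - 1 : ℤ) * θ : ℝ))
        = Complex.exp (Complex.I * (α * Real.cos θ - l * θ : ℝ)) * Complex.exp (θ * Complex.I) := by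
      rw [← Complex.exp_add]; congr 1; push_cast; ring
    have e2 : Complex.exp (Complex.I * (α * Real.cos θ - (l + 1 : ℤ) * θ : ℝ))
        = Complex.exp (Complex.I * (α * Real.cos θ - l * θ : ℝ)) * Complex.exp (-θ * Complex.I) := by
      rw [← Complex.exp_add]; congr 1; push_cast; ring
    have e3 : Complex.exp (Complex.I * (α * Real.cos θ - l * θ : ℝ))
        = Complex.exp (-(Complex.I * (l * θ : ℝ))) * Complex.exp (Complex.I * (α * Real.cos θ : ℝ)) := by
      rw [← Complex.exp_add]; congr 1; push_cast; ring
    have e4 := Complex.two_cos (θ : ℂ)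
    rw [e1, e2, e3, planeData, sub_zero]
    push_cast
    linear_combination (1 / 2) * Complex.exp (-(Complex.I * (l * θ))) *
      Complex.exp (Complex.I * (α * Complex.cos θ)) * e4
  simp only [h1]
  rw [intervalIntegral.integral_add (Continuous.intervalIntegrable (by fun_prop) _ _)
    (Continuous.intervalIntegrable (by fun_prop) _ _), intervalIntegral.integral_const_mul,
    intervalIntegral.integral_add (Continuous.intervalIntegrable (by fun_prop) _ _)
    (Continuous.intervalIntegrable (by fun_prop) _ _), integral_exp_cos_eq_besselJ,
    integral_exp_cos_eq_besselJ, integral_exp_cos_eq_besselJ, deriv_besselJ,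
    zpow_add₀ Complex.I_ne_zero, zpow_sub₀ Complex.I_ne_zero, zpow_one, Complex.div_I]
  push_cast
  ring

theorem fourierCoeffOn_planeData (l : ℤ) (α θ₁ : ℝ) :
    fourierCoeffOn Real.two_pi_pos (planeData α θ₁) l = Complex.exp (-(Complex.I * (l * θ₁ : ℝ))) *
      (Complex.I ^ l * (besselJ l α - Complex.I * ((deriv (besselJ l) α : ℝ) : ℂ))) := by
  have hp : Function.Periodic (fun ψ : ℝ => Complex.exp (-(Complex.I * (l * ψ : ℝ)))
      * planeData α 0 ψ) (2 * Real.pi) := by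
    intro ψ
    have := exp_I_mul_sub_two_pi l (-(l * ψ))
    simp only [planeData, sub_zero, Real.cos_add_two_pi]
    congr 1
    rw [show -(Complex.I * (l * ψ : ℝ)) = Complex.I * (-(l * ψ) : ℝ) by push_cast; ring, ← this]
    congr 1
    push_cast
    ring
  have h1 : ∀ θ : ℝ, Complex.exp (-(Complex.I * (l * θ : ℝ))) * planeData α θ₁ θ
      = Complex.exp (-(Complex.I * (l * θ₁ : ℝ))) *
        (Complex.exp (-(Complex.I * (l * (θ - θ₁) : ℝ))) * planeData α 0 (θ - θ₁)) := by
    intro θ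
    rw [← mul_assoc, ← Complex.exp_add, planeData, planeData, sub_zero]
    congr 2
    push_cast
    ring
  have h2 := hp.intervalIntegral_add_eq 0 (0 - θ₁)
  rw [zero_add, show 0 - θ₁ + 2 * Real.pi = 2 * Real.pi - θ₁ by ring,
    integral_exp_mul_planeData_zero] at h2
  have hpi : (Real.pi : ℂ) ≠ 0 := Complex.ofReal_ne_zero.2 Real.pi_ne_zero
  rw [fourierCoeffOn_eq_integral_exp]
  simp only [h1]
  rw [intervalIntegral.integral_const_mul, intervalIntegral.integral_comp_sub_right
    (fun ψ : ℝ => Complex.exp (-(Complex.I * (l * ψ : ℝ))) * planeData α 0 ψ) θ₁, ← h2]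
  field_simp

/-! ### The filter: exact action on plane waves, stability on noise, location of the peak. -/

/-- The normalised Dirichlet kernel. -/
noncomputable def dirichletMean (N : ℕ) (ψ : ℝ) : ℂ :=
  1 / (2 * (N : ℂ) + 1) * ∑ l ∈ Finset.Icc (-(N : ℤ)) (N : ℤ), Complex.exp (Complex.I * (l * ψ : ℝ))

theorem dirichletMean_zero (N : ℕ) : dirichletMean N 0 = 1 := by
  have : (2 * (N : ℂ) + 1) ≠ 0 := by exact_mod_cast (by omega : 2 * N + 1 ≠ 0)
  simp only [dirichletMean, mul_zero, Complex.ofReal_zero, Complex.exp_zero, Finset.sum_const,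
    Int.card_Icc, nsmul_eq_mul, mul_one]
  rw [show ((N : ℤ) + 1 - -(N : ℤ)).toNat = 2 * N + 1 by omega]
  push_cast
  field_simp

theorem sum_exp_mul_two_sin (N : ℕ) (ψ : ℝ) :
    (∑ l ∈ Finset.Icc (-(N : ℤ)) (N : ℤ), Complex.exp (Complex.I * (l * ψ : ℝ))) *
      (Complex.exp (Complex.I * (ψ / 2 : ℝ)) - Complex.exp (-(Complex.I * (ψ / 2 : ℝ))))
      = Complex.exp (Complex.I * ((N + 1 / 2) * ψ : ℝ))
        - Complex.exp (-(Complex.I * ((N + 1 / 2) * ψ : ℝ))) := by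
  induction N with
  | zero => simp; congr 2 <;> ring_nf
  | succ N ih =>
    push_cast at ih ⊢
    rw [Finset.sum_Icc_succ_eq_add_endpoints, add_mul, ih]
    simp only [add_mul, mul_sub, ← Complex.exp_add]
    push_cast
    ring_nf

theorem norm_dirichletMean_mul_le (N : ℕ) (ψ : ℝ) :
    ‖dirichletMean N ψ‖ * ((2 * N + 1) * |Real.sin (ψ / 2)|) ≤ 1 := by
  have h1 := congrArg norm (sum_exp_mul_two_sin N ψ)
  have h2 : ∀ y : ℝ, ‖Complex.exp (Complex.I * y) - Complex.exp (-(Complex.I * y))‖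
      = 2 * |Real.sin y| := by
    intro y
    have := Complex.two_sin (y : ℂ)
    have e : Complex.exp (Complex.I * y) - Complex.exp (-(Complex.I * y))
        = 2 * Complex.sin y * Complex.I := by
      rw [this, mul_assoc, Complex.I_mul_I]
      ring_nf
    rw [e, norm_mul, norm_mul, Complex.norm_I, ← Complex.ofReal_sin, Complex.norm_real]
    simp
  rw [norm_mul, h2, h2] at h1
  have h3 : ‖1 / (2 * (N : ℂ) + 1)‖ = 1 / (2 * (N : ℝ) + 1) := by
    rw [norm_div, norm_one]
    congr 1
    exact_mod_cast Complex.norm_natCast (2 * N + 1)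
  have h4 := Real.abs_sin_le_one ((N + 1 / 2) * ψ)
  have h5 : (0 : ℝ) < 2 * N + 1 := by positivity
  rw [dirichletMean, norm_mul, h3]
  field_simp
  linarith

theorem norm_besselJ_sub_sq (l : ℤ) (α : ℝ) :
    ‖(besselJ l α : ℂ) - Complex.I * ((deriv (besselJ l) α : ℝ) : ℂ)‖ ^ 2
      = besselJ l α ^ 2 + deriv (besselJ l) α ^ 2 := by
  rw [← Complex.normSq_eq_norm_sq, Complex.normSq_apply]
  simp
  ring

theorem nmlaFilter_planeData {α : ℝ} (θ₁ θ : ℝ)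
    (h : ∀ l ∈ Finset.Icc (-(cutoff α : ℤ)) (cutoff α : ℤ),
      0 < besselJ l α ^ 2 + deriv (besselJ l) α ^ 2) :
    nmlaFilter α (planeData α θ₁) θ = dirichletMean (cutoff α) (θ - θ₁) := by
  rw [nmlaFilter, dirichletMean]
  congr 1
  refine Finset.sum_congr rfl fun l hl => ?_
  have h1 : (besselJ l α : ℂ) - Complex.I * ((deriv (besselJ l) α : ℝ) : ℂ) ≠ 0 := by
    intro h0
    have := norm_besselJ_sub_sq l α
    rw [h0, norm_zero] at this
    linarith [h l hl]
  have h2 : Complex.I ^ l ≠ 0 := zpow_ne_zero _ Complex.I_ne_zero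
  rw [fourierCoeffOn_planeData, div_eq_iff (mul_ne_zero h2 h1),
    mul_right_comm, ← Complex.exp_add, mul_comm (Complex.exp _)]
  rw [mul_comm]
  congr 2
  push_cast
  ring

theorem nmlaFilter_mul_add (α : ℝ) {U V : ℝ → ℂ} (hU : Continuous U) (hV : Continuous V) (B : ℂ)
    (θ : ℝ) : nmlaFilter α (fun θ => B * U θ + V θ) θ
      = B * nmlaFilter α U θ + nmlaFilter α V θ := by
  have h : ∀ l : ℤ, fourierCoeffOn Real.two_pi_pos (fun θ => B * U θ + V θ) l
      = B * fourierCoeffOn Real.two_pi_pos U l + fourierCoeffOn Real.two_pi_pos V l := by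
    intro l
    simp only [fourierCoeffOn_eq_integral_exp, mul_add]
    rw [intervalIntegral.integral_add (Continuous.intervalIntegrable (by fun_prop) _ _)
      (Continuous.intervalIntegrable (by fun_prop) _ _), mul_add]
    congr 1
    rw [mul_left_comm B, ← intervalIntegral.integral_const_mul B]
    simp only [mul_left_comm B]
  simp only [nmlaFilter, h, add_mul, add_div, Finset.sum_add_distrib, mul_add, mul_assoc,
    mul_div_assoc, ← Finset.mul_sum]
  ring

theorem sum_sq_fourierCoeffOn_le {U : ℝ → ℂ} (hU : Continuous U) {M : ℝ} (hM : ∀ θ, ‖U θ‖ ≤ M)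
    (s : Finset ℤ) : ∑ l ∈ s, ‖fourierCoeffOn Real.two_pi_pos U l‖ ^ 2 ≤ M ^ 2 := by
  have hL2 : MemLp U 2 (volume.restrict (Set.Ioc 0 (2 * Real.pi))) :=
    MemLp.of_bound hU.aestronglyMeasurable M (Filter.Eventually.of_forall hM)
  have hsum := hasSum_sq_fourierCoeffOn Real.two_pi_pos hL2
  refine (sum_le_hasSum s (fun _ _ => by positivity) hsum).trans ?_
  have h1 : ∫ x in (0 : ℝ)..(2 * Real.pi), ‖U x‖ ^ 2 ≤ ∫ _ in (0 : ℝ)..(2 * Real.pi), M ^ 2 :=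
    intervalIntegral.integral_mono_on Real.two_pi_pos.le
      (Continuous.intervalIntegrable (by fun_prop) _ _) intervalIntegrable_const
      fun θ _ => pow_le_pow_left₀ (norm_nonneg _) (hM θ) 2
  rw [intervalIntegral.integral_const, smul_eq_mul, sub_zero] at h1
  rw [sub_zero, smul_eq_mul, inv_mul_le_iff₀ Real.two_pi_pos]
  exact h1

/-- Cauchy–Schwarz over the modes; the squared Fourier coefficients sum to at most M² by Bessel's
inequality. -/
theorem norm_nmlaFilter_le (α : ℝ) {U : ℝ → ℂ} (hU : Continuous U) {M : ℝ}
    (hM : ∀ θ, ‖U θ‖ ≤ M) (θ : ℝ) :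
    ‖nmlaFilter α U θ‖ ≤ 1 / (2 * cutoff α + 1) * (M *
      √(∑ l ∈ Finset.Icc (-(cutoff α : ℤ)) (cutoff α : ℤ),
        (besselJ l α ^ 2 + deriv (besselJ l) α ^ 2)⁻¹)) := by
  have hM0 : 0 ≤ M := (norm_nonneg _).trans (hM 0)
  have h3 : ‖1 / (2 * (cutoff α : ℂ) + 1)‖ = 1 / (2 * (cutoff α : ℝ) + 1) := by
    rw [norm_div, norm_one]
    congr 1
    exact_mod_cast Complex.norm_natCast (2 * cutoff α + 1)
  rw [nmlaFilter, norm_mul, h3]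
  refine mul_le_mul_of_nonneg_left ?_ (by positivity)
  refine (norm_sum_le _ _).trans ?_
  have h1 : ∀ l : ℤ, ‖fourierCoeffOn Real.two_pi_pos U l * Complex.exp (Complex.I * l * θ) /
      (Complex.I ^ l * ((besselJ l α : ℂ) - Complex.I * ((deriv (besselJ l) α : ℝ) : ℂ)))‖
      = ‖fourierCoeffOn Real.two_pi_pos U l‖ *
        ‖(besselJ l α : ℂ) - Complex.I * ((deriv (besselJ l) α : ℝ) : ℂ)‖⁻¹ := by
    intro l
    have e : ‖Complex.exp (Complex.I * l * θ)‖ = 1 := by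
      rw [show Complex.I * l * θ = ((l * θ : ℝ) : ℂ) * Complex.I by push_cast; ring,
        Complex.norm_exp_ofReal_mul_I]
    rw [norm_div, norm_mul, norm_mul, norm_zpow, Complex.norm_I, one_zpow, e, mul_one, one_mul,
      div_eq_mul_inv]
  simp only [h1]
  refine (Real.sum_mul_le_sqrt_mul_sqrt _ _ _).trans ?_
  simp only [inv_pow, norm_besselJ_sub_sq]
  refine mul_le_mul_of_nonneg_right ?_ (Real.sqrt_nonneg _)
  exact Real.sqrt_le_iff.2 ⟨hM0, sum_sq_fourierCoeffOn_le hU hM _⟩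

theorem continuous_nmlaFilter (α : ℝ) (U : ℝ → ℂ) : Continuous (nmlaFilter α U) := by
  unfold nmlaFilter
  fun_prop

theorem periodic_nmlaFilter (α : ℝ) (U : ℝ → ℂ) :
    Function.Periodic (nmlaFilter α U) (2 * Real.pi) := by
  intro θ
  unfold nmlaFilter
  congr 1
  refine Finset.sum_congr rfl fun l _ => ?_
  congr 2
  rw [← Complex.exp_periodic.int_mul l (Complex.I * l * θ)]
  congr 1
  push_cast
  ring

theorem exists_isMax_nmlaFilter (α : ℝ) (U : ℝ → ℂ) :
    ∃ θs : ℝ, ∀ θ : ℝ, ‖nmlaFilter α U θ‖ ≤ ‖nmlaFilter α U θs‖ := by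
  obtain ⟨θs, -, h⟩ := isCompact_Icc.exists_isMaxOn
    (Set.nonempty_Icc.2 Real.two_pi_pos.le) (continuous_nmlaFilter α U).norm.continuousOn
  refine ⟨θs, fun θ => ?_⟩
  obtain ⟨θ', hθ', e⟩ := (periodic_nmlaFilter α U).exists_mem_Ico₀ Real.two_pi_pos θ
  rw [e]
  exact h (Set.Ico_subset_Icc_self hθ')

/-- If the deviation from plane wave data is below `0.13` of the amplitude, the maximum of the
filtered data is within `O(1/α)` of the direction of the plane wave. -/
theorem abs_sin_le_of_isMax {α : ℝ} (hα : 1000 ≤ α) (hα' : (1400 * Real.exp 410) ^ 3 ≤ α)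
    {B : ℂ} (hB : 0 < ‖B‖) {V : ℝ → ℂ} (hV : Continuous V) (hV' : ∀ θ, ‖V θ‖ ≤ 0.13 * ‖B‖)
    {θ₁ θs : ℝ} (hmax : ‖nmlaFilter α (fun θ => B * planeData α θ₁ θ + V θ) θ₁‖
      ≤ ‖nmlaFilter α (fun θ => B * planeData α θ₁ θ + V θ) θs‖) :
    |Real.sin ((θs - θ₁) / 2)| ≤ 8 / α := by
  have hα0 : 0 < α := by linarith
  obtain ⟨a, ha0, rfl⟩ : ∃ a : ℝ, 0 < a ∧ a ^ 3 = α :=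
    ⟨α ^ (1 / 3 : ℝ), by positivity, by
      rw [← Real.rpow_natCast, ← Real.rpow_mul hα0.le]; norm_num⟩
  have ha : 10 ≤ a := le_of_pow_le_pow_left₀ three_ne_zero ha0.le (by norm_num; linarith)
  have ha' : 1400 * Real.exp 410 ≤ a := le_of_pow_le_pow_left₀ three_ne_zero ha0.le hα'
  set N := cutoff (a ^ 3) with hN
  have hN1 : a ^ 3 < N + 1 := lt_cutoff_add_one _
  have hS := sum_inv_besselJ_energy_le ha ha'
  have hpos : ∀ l ∈ Finset.Icc (-(N : ℤ)) (N : ℤ),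
      0 < besselJ l (a ^ 3) ^ 2 + deriv (besselJ l) (a ^ 3) ^ 2 := by
    intro l hl
    rw [Finset.mem_Icc] at hl
    have : |(l : ℝ)| ≤ N := by exact_mod_cast abs_le.2 hl
    exact (inv_besselJ_energy_le ha (this.trans (cutoff_cast_le (by linarith)))).1
  -- Since 2N + 1 ≥ 1.999 a³ for large a, the constant 3.25 works because (3.25 · 1.999)² > 41.
  have hsq : √(∑ l ∈ Finset.Icc (-(N : ℤ)) (N : ℤ),
      (besselJ l (a ^ 3) ^ 2 + deriv (besselJ l) (a ^ 3) ^ 2)⁻¹) ≤ 3.25 * (2 * N + 1) := by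
    refine Real.sqrt_le_iff.2 ⟨by positivity, hS.trans ?_⟩
    have : 1.999 * a ^ 3 ≤ 2 * N + 1 := by linarith
    have := pow_le_pow_left₀ (by positivity) this 2
    nlinarith
  have herr : ∀ θ, ‖nmlaFilter (a ^ 3) V θ‖ ≤ 7 / 16 * ‖B‖ := by
    intro θ
    refine (norm_nmlaFilter_le _ hV hV' θ).trans ?_
    have h5 : (0 : ℝ) < 2 * N + 1 := by positivity
    calc _ ≤ 1 / (2 * (N : ℝ) + 1) * (0.13 * ‖B‖ * (3.25 * (2 * N + 1))) := by gcongr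
      _ = 0.4225 * ‖B‖ := by field_simp; norm_num
      _ ≤ _ := by gcongr; norm_num
  rw [nmlaFilter_mul_add _ (continuous_planeData _ _) hV, nmlaFilter_mul_add _
    (continuous_planeData _ _) hV, nmlaFilter_planeData _ _ hpos, nmlaFilter_planeData _ _ hpos,
    sub_self, dirichletMean_zero, mul_one] at hmax
  have h1 : ‖B‖ - 7 / 16 * ‖B‖ ≤ ‖B + nmlaFilter (a ^ 3) V θ₁‖ := by
    have := norm_sub_le_norm_add B (nmlaFilter (a ^ 3) V θ₁)
    linarith [herr θ₁]
  have h2 := norm_add_le (B * dirichletMean N (θs - θ₁)) (nmlaFilter (a ^ 3) V θs)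
  rw [norm_mul] at h2
  -- At θ₁ the output is at least 9/16 of ‖B‖, and at θs the noise supplies at most 7/16, so the
  -- kernel must supply the remaining 1/8.
  have h3 : 1 / 8 * ‖B‖ ≤ ‖dirichletMean N (θs - θ₁)‖ * ‖B‖ := by
    linarith [herr θs]
  have h4 := le_of_mul_le_mul_right h3 hB
  have h5 := norm_dirichletMean_mul_le N (θs - θ₁)
  have h6 : 1 / 8 * (a ^ 3 * |Real.sin ((θs - θ₁) / 2)|) ≤ 1 := by
    refine le_trans ?_ h5
    refine mul_le_mul h4 ?_ (by positivity) (norm_nonneg _)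
    refine mul_le_mul_of_nonneg_right ?_ (abs_nonneg _)
    linarith
  rw [le_div_iff₀ hα0]
  linarith

/-! ### Directions in the plane and impedance data of explicit fields. -/

theorem inner_dir (a b : ℝ) : inner ℝ (dir a) (dir b) = Real.cos (a - b) := by
  rw [dir, dir, EuclideanSpace.inner_eq_star_dotProduct, Real.cos_sub]
  simp [dotProduct, Fin.sum_univ_two]
  ring

theorem norm_dir (θ : ℝ) : ‖dir θ‖ = 1 := by
  rw [← sq_eq_sq₀ (norm_nonneg _) zero_le_one, ← real_inner_self_eq_norm_sq, inner_dir]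
  simp

theorem exists_eq_dir {d : Plane} (hd : ‖d‖ = 1) : ∃ θ : ℝ, d = dir θ := by
  have h : d 0 ^ 2 + d 1 ^ 2 = 1 := by
    have := EuclideanSpace.norm_sq_eq d
    rw [hd, Fin.sum_univ_two] at this
    simpa using this.symm
  set z : ℂ := ⟨d 0, d 1⟩ with hz
  have hn : ‖z‖ = 1 := by
    rw [← sq_eq_sq₀ (norm_nonneg _) zero_le_one, ← Complex.normSq_eq_norm_sq, Complex.normSq_apply]
    simp only [hz]; linarith
  have h1 := Complex.norm_mul_cos_arg z
  have h2 := Complex.norm_mul_sin_arg z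
  rw [hn, one_mul] at h1 h2
  refine ⟨z.arg, ?_⟩
  ext i
  fin_cases i
  · simpa [dir] using h1.symm
  · simpa [dir] using h2.symm

theorem dir_add_int_mul_two_pi (θ : ℝ) (n : ℤ) : dir (θ + n * (2 * Real.pi)) = dir θ := by
  simp [dir, Real.cos_add_int_mul_two_pi, Real.sin_add_int_mul_two_pi]

theorem norm_dir_sub_le (a b : ℝ) : ‖dir a - dir b‖ ≤ |a - b| := by
  refine abs_le_of_sq_le_sq' ?_ (abs_nonneg _) |>.2
  rw [norm_sub_sq_real, norm_dir, norm_dir, inner_dir, sq_abs]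
  linarith [Real.one_sub_sq_div_two_le_cos (x := a - b)]

theorem continuous_dir : Continuous dir := by
  unfold dir
  fun_prop

theorem impedance_waveField {A : Plane → ℂ} {φ : Plane → ℝ} {x₀ : Plane} {η₀ ω r θ : ℝ}
    {A' : Plane →L[ℝ] ℂ} {φ' : Plane →L[ℝ] ℝ} (hη₀ : η₀ ≠ 0) (hω : ω ≠ 0)
    (hA : HasFDerivAt A A' (x₀ + r • dir θ)) (hφ : HasFDerivAt φ φ' (x₀ + r • dir θ)) :
    impedance (ω * η₀) r x₀ (waveField A φ ω) θ =
      Complex.exp (Complex.I * ω * φ (x₀ + r • dir θ)) *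
        (A' (dir θ) / (Complex.I * (ω * η₀ : ℝ))
          + A (x₀ + r • dir θ) * (1 + φ' (dir θ) / η₀ : ℝ)) := by
  have hray : HasDerivAt (fun ρ : ℝ => x₀ + ρ • dir θ) (dir θ) r := by
    simpa using ((hasDerivAt_id r).smul_const (dir θ)).const_add x₀
  have h1 := hA.comp_hasDerivAt r hray
  have h2 := ((hφ.comp_hasDerivAt r hray).ofReal_comp.const_mul (Complex.I * ω)).cexp
  have h3 : HasDerivAt (fun ρ : ℝ => waveField A φ ω (x₀ + ρ • dir θ)) _ r := h1.mul h2
  rw [impedance, h3.deriv, waveField]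
  have e1 : (η₀ : ℂ) ≠ 0 := Complex.ofReal_ne_zero.2 hη₀
  have e2 : (ω : ℂ) ≠ 0 := Complex.ofReal_ne_zero.2 hω
  have e3 := Complex.I_ne_zero
  simp only [Function.comp]
  push_cast
  field_simp
  ring

theorem impedance_planeWave (A : Plane → ℂ) {φ : Plane → ℝ} {x₀ : Plane} {η₀ ω θ₁ : ℝ}
    (r : ℝ) (hη₀ : η₀ ≠ 0) (hω : ω ≠ 0) (hgrad : gradient φ x₀ = η₀ • dir θ₁) (θ : ℝ) :
    impedance (ω * η₀) r x₀ (planeWave A φ x₀ ω) θ =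
      planeWave A φ x₀ ω x₀ * planeData (ω * η₀ * r) θ₁ θ := by
  have hlin : HasFDerivAt (linPhase φ x₀) (innerSL ℝ (gradient φ x₀)) (x₀ + r • dir θ) := by
    have := ((innerSL ℝ (gradient φ x₀)).hasFDerivAt (x := x₀ + r • dir θ - x₀)).comp
      (x₀ + r • dir θ) ((hasFDerivAt_id (x₀ + r • dir θ)).sub_const x₀)
    exact this.const_add (φ x₀)
  rw [planeWave, impedance_waveField hη₀ hω (hasFDerivAt_const _ _) hlin]
  have e1 : innerSL ℝ (gradient φ x₀) (dir θ) = η₀ * Real.cos (θ - θ₁) := by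
    rw [innerSL_apply_apply, hgrad, real_inner_smul_left, inner_dir, ← Real.cos_neg, neg_sub]
  have e2 : linPhase φ x₀ (x₀ + r • dir θ) = φ x₀ + r * (η₀ * Real.cos (θ - θ₁)) := by
    rw [linPhase, add_sub_cancel_left, inner_smul_right, ← e1, innerSL_apply_apply]
  have e3 : linPhase φ x₀ x₀ = φ x₀ := by simp [linPhase]
  rw [e1, e2, waveField, e3, planeData, mul_div_cancel_left₀ _ hη₀]
  have e4 : Complex.exp (Complex.I * ω * (φ x₀ + r * (η₀ * Real.cos (θ - θ₁)) : ℝ))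
      = Complex.exp (Complex.I * ω * φ x₀) *
        Complex.exp (Complex.I * (ω * η₀ * r * Real.cos (θ - θ₁) : ℝ)) := by
    rw [← Complex.exp_add]; congr 1; push_cast; ring
  rw [e4]
  simp only [zero_apply, zero_div, zero_add]
  ring

theorem norm_planeWave_center (A : Plane → ℂ) (φ : Plane → ℝ) (x₀ : Plane) (ω : ℝ) :
    ‖planeWave A φ x₀ ω x₀‖ = ‖A x₀‖ := by
  rw [planeWave, waveField, norm_mul, show Complex.I * ω * (linPhase φ x₀ x₀ : ℝ)
    = ((ω * linPhase φ x₀ x₀ : ℝ) : ℂ) * Complex.I by push_cast; ring,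
    Complex.norm_exp_ofReal_mul_I, mul_one]

/-! ### Deviation of a smooth front from its plane wave. -/

namespace IsSmoothFront

variable {η₀ R C₁ C₂ C₃ : ℝ} {A : Plane → ℂ} {φ : Plane → ℝ} {x₀ d₀ : Plane}

theorem mem_ball {r : ℝ} (hr : 0 ≤ r) (hrR : r < R) (θ : ℝ) :
    x₀ + r • dir θ ∈ Metric.ball x₀ R := by
  rw [mem_ball_iff_norm, add_sub_cancel_left, norm_smul, norm_dir, mul_one, Real.norm_eq_abs,
    abs_of_nonneg hr]
  exact hrR

theorem hasFDerivAt_amplitude (h : IsSmoothFront η₀ R C₁ C₂ C₃ A φ x₀ d₀) {x : Plane}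
    (hx : x ∈ Metric.ball x₀ R) : HasFDerivAt A (fderiv ℝ A x) x :=
  ((h.smooth_amplitude.differentiableOn one_ne_zero).differentiableAt
    (Metric.isOpen_ball.mem_nhds hx)).hasFDerivAt

theorem hasFDerivAt_phase (h : IsSmoothFront η₀ R C₁ C₂ C₃ A φ x₀ d₀) {x : Plane}
    (hx : x ∈ Metric.ball x₀ R) : HasFDerivAt φ (fderiv ℝ φ x) x :=
  ((h.smooth_phase.differentiableOn two_ne_zero).differentiableAt
    (Metric.isOpen_ball.mem_nhds hx)).hasFDerivAt

theorem hasFDerivAt_fderiv_phase (h : IsSmoothFront η₀ R C₁ C₂ C₃ A φ x₀ d₀) {x : Plane}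
    (hx : x ∈ Metric.ball x₀ R) :
    HasFDerivAt (fderiv ℝ φ) (fderiv ℝ (fderiv ℝ φ) x) x :=
  (((h.smooth_phase.fderiv_of_isOpen Metric.isOpen_ball
    (m := 1) (by norm_num)).differentiableOn one_ne_zero).differentiableAt
    (Metric.isOpen_ball.mem_nhds hx)).hasFDerivAt

theorem curvature_nonneg (h : IsSmoothFront η₀ R C₁ C₂ C₃ A φ x₀ d₀) (hR : 0 < R) : 0 ≤ C₃ :=
  (abs_nonneg _).trans (h.curvature_le x₀ (Metric.mem_ball_self hR) (dir 0) (norm_dir 0))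

theorem fderiv_phase_center (h : IsSmoothFront η₀ R C₁ C₂ C₃ A φ x₀ d₀) (s : Plane) :
    fderiv ℝ φ x₀ s = η₀ * inner ℝ d₀ s := by
  rw [← real_inner_smul_left, ← h.gradient_phase, gradient, InnerProductSpace.toDual_symm_apply]

theorem hasDerivAt_ray (x₀ s : Plane) (ρ : ℝ) : HasDerivAt (fun ρ : ℝ => x₀ + ρ • s) s ρ := by
  simpa using ((hasDerivAt_id ρ).smul_const s).const_add x₀

theorem norm_amplitude_sub_le (h : IsSmoothFront η₀ R C₁ C₂ C₃ A φ x₀ d₀) {r : ℝ} (hr : 0 ≤ r)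
    (hrR : r < R) (θ : ℝ) : ‖A (x₀ + r • dir θ) - A x₀‖ ≤ C₁ * r := by
  have hmem : ∀ ρ ∈ Set.Icc 0 r, x₀ + ρ • dir θ ∈ Metric.ball x₀ R := fun ρ hρ =>
    mem_ball hρ.1 (hρ.2.trans_lt hrR) θ
  have hD : ∀ ρ ∈ Set.Icc 0 r, HasDerivAt (fun ρ : ℝ => A (x₀ + ρ • dir θ) - A x₀)
      (fderiv ℝ A (x₀ + ρ • dir θ) (dir θ)) ρ := fun ρ hρ =>
    ((h.hasFDerivAt_amplitude (hmem ρ hρ)).comp_hasDerivAt ρ (hasDerivAt_ray x₀ _ ρ)).sub_const _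
  refine image_norm_le_of_norm_deriv_right_le_deriv_boundary
    (fun ρ hρ => (hD ρ hρ).continuousAt.continuousWithinAt)
    (fun ρ hρ => (hD ρ (Set.Ico_subset_Icc_self hρ)).hasDerivWithinAt) (B := fun ρ => C₁ * ρ)
    (B' := fun _ => C₁) (by simp) (fun ρ => by simpa using (hasDerivAt_id ρ).const_mul C₁)
    (fun ρ hρ => ?_) (Set.right_mem_Icc.2 hr)
  refine (ContinuousLinearMap.le_opNorm _ _).trans ?_
  rw [norm_dir, mul_one]
  exact h.gradient_amplitude_le _ (hmem ρ (Set.Ico_subset_Icc_self hρ))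

theorem abs_fderiv_phase_sub_le (h : IsSmoothFront η₀ R C₁ C₂ C₃ A φ x₀ d₀) {r : ℝ} (hr : 0 ≤ r)
    (hrR : r < R) (θ : ℝ) :
    |fderiv ℝ φ (x₀ + r • dir θ) (dir θ) - fderiv ℝ φ x₀ (dir θ)| ≤ C₃ * r := by
  have hmem : ∀ ρ ∈ Set.Icc 0 r, x₀ + ρ • dir θ ∈ Metric.ball x₀ R := fun ρ hρ =>
    mem_ball hρ.1 (hρ.2.trans_lt hrR) θ
  have hD : ∀ ρ ∈ Set.Icc 0 r, HasDerivAt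
      (fun ρ : ℝ => fderiv ℝ φ (x₀ + ρ • dir θ) (dir θ) - fderiv ℝ φ x₀ (dir θ))
      (fderiv ℝ (fderiv ℝ φ) (x₀ + ρ • dir θ) (dir θ) (dir θ)) ρ := fun ρ hρ => by
    have h1 := (h.hasFDerivAt_fderiv_phase (hmem ρ hρ)).comp_hasDerivAt ρ (hasDerivAt_ray x₀ _ ρ)
    simpa using (h1.clm_apply (hasDerivAt_const ρ (dir θ))).sub_const (fderiv ℝ φ x₀ (dir θ))
  exact image_norm_le_of_norm_deriv_right_le_deriv_boundary
    (fun ρ hρ => (hD ρ hρ).continuousAt.continuousWithinAt)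
    (fun ρ hρ => (hD ρ (Set.Ico_subset_Icc_self hρ)).hasDerivWithinAt) (B := fun ρ => C₃ * ρ)
    (B' := fun _ => C₃) (by simp) (fun ρ => by simpa using (hasDerivAt_id ρ).const_mul C₃)
    (fun ρ hρ => h.curvature_le _ (hmem ρ (Set.Ico_subset_Icc_self hρ)) _ (norm_dir θ))
    (Set.right_mem_Icc.2 hr)

/-- Second-order Taylor estimate along the ray in direction `dir θ`; only the second derivative
along the ray enters, so C₃ suffices. -/
theorem abs_phase_sub_linPhase_le (h : IsSmoothFront η₀ R C₁ C₂ C₃ A φ x₀ d₀) {r : ℝ}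
    (hr : 0 ≤ r) (hrR : r < R) (θ : ℝ) :
    |φ (x₀ + r • dir θ) - linPhase φ x₀ (x₀ + r • dir θ)| ≤ C₃ * r ^ 2 / 2 := by
  have hmem : ∀ ρ ∈ Set.Icc 0 r, x₀ + ρ • dir θ ∈ Metric.ball x₀ R := fun ρ hρ =>
    mem_ball hρ.1 (hρ.2.trans_lt hrR) θ
  have hlin : ∀ ρ : ℝ, linPhase φ x₀ (x₀ + ρ • dir θ) = φ x₀ + ρ * fderiv ℝ φ x₀ (dir θ) := by
    intro ρ
    rw [linPhase, add_sub_cancel_left, inner_smul_right, h.fderiv_phase_center, h.gradient_phase,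
      real_inner_smul_left]
  have hD : ∀ ρ ∈ Set.Icc 0 r, HasDerivAt
      (fun ρ : ℝ => φ (x₀ + ρ • dir θ) - (φ x₀ + ρ * fderiv ℝ φ x₀ (dir θ)))
      (fderiv ℝ φ (x₀ + ρ • dir θ) (dir θ) - fderiv ℝ φ x₀ (dir θ)) ρ := fun ρ hρ => by
    have h1 := (h.hasFDerivAt_phase (hmem ρ hρ)).comp_hasDerivAt ρ (hasDerivAt_ray x₀ _ ρ)
    have h2 := ((hasDerivAt_id ρ).mul_const (fderiv ℝ φ x₀ (dir θ))).const_add (φ x₀)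
    exact (h1.sub h2).congr_deriv (by simp)
  rw [hlin]
  exact image_norm_le_of_norm_deriv_right_le_deriv_boundary
    (fun ρ hρ => (hD ρ hρ).continuousAt.continuousWithinAt)
    (fun ρ hρ => (hD ρ (Set.Ico_subset_Icc_self hρ)).hasDerivWithinAt)
    (B := fun ρ => C₃ * ρ ^ 2 / 2) (B' := fun ρ => C₃ * ρ) (by simp)
    (fun ρ => by
      refine ((((hasDerivAt_id ρ).pow 2).const_mul C₃).div_const 2).congr_deriv ?_
      simp; ring)
    (fun ρ hρ => h.abs_fderiv_phase_sub_le hρ.1 (hρ.2.trans hrR) θ)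
    (Set.right_mem_Icc.2 hr)

theorem continuous_impedance (h : IsSmoothFront η₀ R C₁ C₂ C₃ A φ x₀ d₀) {ω r : ℝ}
    (hη₀ : η₀ ≠ 0) (hω : ω ≠ 0) (hr : 0 ≤ r) (hrR : r < R) :
    Continuous (impedance (ω * η₀) r x₀ (waveField A φ ω)) := by
  have hmem : ∀ θ, x₀ + r • dir θ ∈ Metric.ball x₀ R := mem_ball hr hrR
  have hdir := continuous_dir
  have hx : Continuous fun θ => x₀ + r • dir θ := by fun_prop
  have hA := h.smooth_amplitude.continuousOn.comp_continuous hx hmem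
  have hφ := h.smooth_phase.continuousOn.comp_continuous hx hmem
  have hA' := (h.smooth_amplitude.continuousOn_fderiv_of_isOpen Metric.isOpen_ball
    le_rfl).comp_continuous hx hmem
  have hφ' := (h.smooth_phase.continuousOn_fderiv_of_isOpen Metric.isOpen_ball
    one_le_two).comp_continuous hx hmem
  have e : impedance (ω * η₀) r x₀ (waveField A φ ω) = fun θ =>
      Complex.exp (Complex.I * ω * φ (x₀ + r • dir θ)) *
        (fderiv ℝ A (x₀ + r • dir θ) (dir θ) / (Complex.I * (ω * η₀ : ℝ))
          + A (x₀ + r • dir θ) * (1 + fderiv ℝ φ (x₀ + r • dir θ) (dir θ) / η₀ : ℝ)) :=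
    funext fun θ => impedance_waveField hη₀ hω (h.hasFDerivAt_amplitude (hmem θ))
      (h.hasFDerivAt_phase (hmem θ))
  rw [e]
  exact (Complex.continuous_exp.comp (continuous_const.mul
    (Complex.continuous_ofReal.comp hφ))).mul (((hA'.clm_apply hdir).div_const _).add
    (hA.mul (Complex.continuous_ofReal.comp
      (continuous_const.add ((hφ'.clm_apply hdir).div_const _)))))

theorem norm_deltaU_le (h : IsSmoothFront η₀ R C₁ C₂ C₃ A φ x₀ d₀) {ω r : ℝ}
    (hη₀ : 0 < η₀) (hω : 0 < ω) (hr : 0 ≤ r) (hrR : r < R) (θ : ℝ) :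
    ‖deltaU A φ x₀ η₀ ω r θ‖ ≤ ω * r ^ 2 * C₃ * ‖A x₀‖ +
      (C₁ / (ω * η₀) + C₂ * C₃ * r / η₀ + 2 * C₁ * r) := by
  obtain ⟨θ₁, hd⟩ := exists_eq_dir h.norm_direction
  have hR : 0 < R := hr.trans_lt hrR
  have hx := mem_ball (x₀ := x₀) hr hrR θ
  set x := x₀ + r • dir θ with hxdef
  have hC₃ := h.curvature_nonneg hR
  have hC₁ : 0 ≤ C₁ := (norm_nonneg _).trans (h.gradient_amplitude_le x hx)
  have hlin : HasFDerivAt (linPhase φ x₀) (innerSL ℝ (gradient φ x₀)) x := by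
    have := ((innerSL ℝ (gradient φ x₀)).hasFDerivAt (x := x - x₀)).comp
      x ((hasFDerivAt_id x).sub_const x₀)
    exact this.const_add (φ x₀)
  have hs0 : innerSL ℝ (gradient φ x₀) (dir θ) = η₀ * Real.cos (θ₁ - θ) := by
    rw [innerSL_apply_apply, h.gradient_phase, hd, real_inner_smul_left, inner_dir]
  have hs1 : fderiv ℝ φ x₀ (dir θ) = η₀ * Real.cos (θ₁ - θ) := by
    rw [h.fderiv_phase_center, hd, inner_dir]
  rw [deltaU, planeWave, impedance_waveField hη₀.ne' hω.ne' (h.hasFDerivAt_amplitude hx)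
    (h.hasFDerivAt_phase hx), impedance_waveField hη₀.ne' hω.ne' (hasFDerivAt_const _ _) hlin,
    ← hxdef, hs0, mul_div_cancel_left₀ _ hη₀.ne']
  set c := Real.cos (θ₁ - θ) with hc
  have hexp : ∀ y : ℝ, ‖Complex.exp (Complex.I * ω * y)‖ = 1 := fun y => by
    rw [show Complex.I * ω * y = ((ω * y : ℝ) : ℂ) * Complex.I by push_cast; ring,
      Complex.norm_exp_ofReal_mul_I]
  set E := Complex.exp (Complex.I * ω * φ x) with hE
  set E₀ := Complex.exp (Complex.I * ω * linPhase φ x₀ x) with hE₀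
  have hEE : ‖E - E₀‖ ≤ ω * (C₃ * r ^ 2 / 2) := by
    have e : E - E₀ = E₀ * (Complex.exp (Complex.I * (ω * (φ x - linPhase φ x₀ x) : ℝ)) - 1) := by
      rw [mul_sub, hE₀, ← Complex.exp_add, mul_one, hE]
      congr 2
      push_cast
      ring
    rw [e, norm_mul, hexp, one_mul]
    refine Real.norm_exp_I_mul_ofReal_sub_one_le.trans ?_
    rw [norm_mul, Real.norm_eq_abs, Real.norm_eq_abs, abs_of_pos hω]
    exact mul_le_mul_of_nonneg_left (h.abs_phase_sub_linPhase_le hr hrR θ) hω.le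
  set e := fderiv ℝ φ x (dir θ) / η₀ - c with hedef
  have he : |e| ≤ C₃ * r / η₀ := by
    have : e = (fderiv ℝ φ x (dir θ) - fderiv ℝ φ x₀ (dir θ)) / η₀ := by
      rw [hedef, hs1]; field_simp
    rw [this, abs_div, abs_of_pos hη₀]
    gcongr
    exact h.abs_fderiv_phase_sub_le hr hrR θ
  have hsplit : fderiv ℝ φ x (dir θ) / η₀ = c + e := by rw [hedef]; ring
  have hc2 : ‖((1 + c : ℝ) : ℂ)‖ ≤ 2 := by
    rw [Complex.norm_real, Real.norm_eq_abs, abs_le]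
    constructor <;> linarith [Real.cos_le_one (θ₁ - θ), Real.neg_one_le_cos (θ₁ - θ)]
  have hE1 : ‖E‖ = 1 := hexp _
  rw [hsplit]
  -- The four terms come from the amplitude gradient, the change of the radial phase derivative, the
  -- variation of the amplitude, and the phase error. With r of order ω^(-1/2) only the last is
  -- O(1): the 1/2 of Taylor's formula cancels |1 + c| ≤ 2.
  have hsum : E * (fderiv ℝ A x (dir θ) / (Complex.I * (ω * η₀ : ℝ)) + A x * (1 + (c + e) : ℝ))
      - E₀ * ((0 : Plane →L[ℝ] ℂ) (dir θ) / (Complex.I * (ω * η₀ : ℝ)) + A x₀ * (1 + c : ℝ))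
      = E * (fderiv ℝ A x (dir θ) / (Complex.I * (ω * η₀ : ℝ))) + E * (A x * (e : ℝ))
        + E * ((A x - A x₀) * (1 + c : ℝ)) + (E - E₀) * (A x₀ * (1 + c : ℝ)) := by
    simp only [zero_apply, zero_div, zero_add]
    push_cast
    ring
  rw [hsum]
  have t1 : ‖E * (fderiv ℝ A x (dir θ) / (Complex.I * (ω * η₀ : ℝ)))‖ ≤ C₁ / (ω * η₀) := by
    rw [norm_mul, hE1, one_mul, norm_div, norm_mul, Complex.norm_I, one_mul, Complex.norm_real,
      Real.norm_eq_abs, abs_of_pos (mul_pos hω hη₀)]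
    gcongr
    refine (ContinuousLinearMap.le_opNorm _ _).trans ?_
    rw [norm_dir, mul_one]
    exact h.gradient_amplitude_le x hx
  have t2 : ‖E * (A x * (e : ℝ))‖ ≤ C₂ * C₃ * r / η₀ := by
    rw [norm_mul, hE1, one_mul, norm_mul, Complex.norm_real, Real.norm_eq_abs, mul_assoc,
      mul_div_assoc]
    exact mul_le_mul (h.amplitude_le x hx) he (abs_nonneg _)
      ((norm_nonneg _).trans (h.amplitude_le x hx))
  have t3 : ‖E * ((A x - A x₀) * (1 + c : ℝ))‖ ≤ 2 * C₁ * r := by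
    rw [norm_mul, hE1, one_mul, norm_mul]
    refine (mul_le_mul (h.norm_amplitude_sub_le hr hrR θ) hc2 (norm_nonneg _)
      (mul_nonneg hC₁ hr)).trans_eq (by ring)
  have t4 : ‖(E - E₀) * (A x₀ * (1 + c : ℝ))‖ ≤ ω * r ^ 2 * C₃ * ‖A x₀‖ := by
    rw [norm_mul, norm_mul]
    calc _ ≤ ω * (C₃ * r ^ 2 / 2) * (‖A x₀‖ * 2) := by gcongr
      _ = _ := by ring
  have n1 := norm_add_le (E * (fderiv ℝ A x (dir θ) / (Complex.I * (ω * η₀ : ℝ)))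
    + E * (A x * (e : ℝ)) + E * ((A x - A x₀) * (1 + c : ℝ))) ((E - E₀) * (A x₀ * (1 + c : ℝ)))
  have n2 := norm_add_le (E * (fderiv ℝ A x (dir θ) / (Complex.I * (ω * η₀ : ℝ)))
    + E * (A x * (e : ℝ))) (E * ((A x - A x₀) * (1 + c : ℝ)))
  have n3 := norm_add_le (E * (fderiv ℝ A x (dir θ) / (Complex.I * (ω * η₀ : ℝ))))
    (E * (A x * (e : ℝ)))
  linarith

end IsSmoothFront

theorem IsSmoothFront.norm_deltaU_le_of_le {η₀ R C₁ C₂ C₃ Cε : ℝ} {A : Plane → ℂ} {φ : Plane → ℝ}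
    {x₀ d₀ : Plane} (h : IsSmoothFront η₀ R C₁ C₂ C₃ A φ x₀ d₀) (hη₀ : 0 < η₀) (hCε : 0 < Cε)
    {ω : ℝ} (hω : 1 ≤ √ω) (hR : Cε / √ω < R) (θ : ℝ) :
    ‖deltaU A φ x₀ η₀ ω (Cε / √ω) θ‖ ≤ Cε ^ 2 * C₃ * ‖A x₀‖ +
      (C₁ / η₀ + C₂ * C₃ * Cε / η₀ + 2 * C₁ * Cε) / √ω := by
  have hs : 0 < √ω := by linarith
  have hω0 : 0 < ω := Real.sqrt_pos.1 hs
  have hsq : √ω ^ 2 = ω := Real.sq_sqrt hω0.le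
  have hr : 0 < Cε / √ω := by positivity
  have hC₁ : 0 ≤ C₁ := (norm_nonneg _).trans
    (h.gradient_amplitude_le x₀ (Metric.mem_ball_self (hr.trans hR)))
  refine (h.norm_deltaU_le hη₀ hω0 hr.le hR θ).trans ?_
  have h1 : C₁ / (ω * η₀) ≤ C₁ / η₀ / √ω := by
    rw [div_div, mul_comm η₀]
    gcongr
    nlinarith
  have h2 : ω * (Cε / √ω) ^ 2 = Cε ^ 2 := by
    rw [div_pow, hsq]; field_simp
  have h3 : (C₁ / η₀ + C₂ * C₃ * Cε / η₀ + 2 * C₁ * Cε) / √ω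
      = C₁ / η₀ / √ω + C₂ * C₃ * (Cε / √ω) / η₀ + 2 * C₁ * (Cε / √ω) := by ring
  rw [h2, h3]
  linarith

/-! ### From the half-angle sine to angles, and the conclusion. -/

theorem exists_abs_sub_le_pi (θ θ₀ : ℝ) :
    ∃ θ₁ : ℝ, dir θ₀ = dir θ₁ ∧ |θ₁ - θ| ≤ Real.pi := by
  have hpi := Real.pi_pos
  refine ⟨θ₀ + round ((θ - θ₀) / (2 * Real.pi)) * (2 * Real.pi),
    (dir_add_int_mul_two_pi _ _).symm, ?_⟩
  have h1 := abs_sub_round ((θ - θ₀) / (2 * Real.pi))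
  have h2 : θ₀ + round ((θ - θ₀) / (2 * Real.pi)) * (2 * Real.pi) - θ
      = -(((θ - θ₀) / (2 * Real.pi) - round ((θ - θ₀) / (2 * Real.pi))) * (2 * Real.pi)) := by
    field_simp
    ring
  rw [h2, abs_neg, abs_mul, abs_of_pos (by positivity : 0 < 2 * Real.pi)]
  nlinarith

theorem abs_le_of_abs_sin_half_le {ψ c : ℝ} (hψ : |ψ| ≤ Real.pi) (h : |Real.sin (ψ / 2)| ≤ c) :
    |ψ| ≤ Real.pi * c := by
  have hpi := Real.pi_pos
  have h1 : |ψ / 2| ≤ Real.pi / 2 := by rw [abs_div, abs_two]; linarith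
  have h2 := (Real.mul_abs_le_abs_sin h1).trans h
  rw [abs_div, abs_two] at h2
  have h3 : 2 / Real.pi * (|ψ| / 2) = |ψ| / Real.pi := by ring
  rw [h3, div_le_iff₀ hpi] at h2
  linarith

theorem noiseCondition_of_norm_le {δU : ℝ → ℂ} {b : ℂ} (hb : 0 < ‖b‖)
    (h : ∀ θ, ‖δU θ‖ ≤ 0.13 * ‖b‖) {B : ℝ} (hB : 0 < B) (hB' : B ≤ 0.89) :
    NoiseCondition B δU b := by
  have h1 : 0.13 * ‖b‖ < ‖b‖ / (4 * B) := by
    rw [lt_div_iff₀ (by positivity)]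
    nlinarith
  rw [NoiseCondition, eLpNorm_exponent_top]
  refine (eLpNormEssSup_le_of_ae_bound (Filter.Eventually.of_forall h)).trans_lt ?_
  exact (ENNReal.ofReal_lt_ofReal_iff_of_nonneg (by positivity)).2 h1

end RayNMLA

open RayNMLA in
theorem mainTheorem3 (η₀ R C₁ C₂ C₃ Cε : ℝ) (hη₀ : 0 < η₀) (hR : 0 < R) (hCε : 0 < Cε) :
    -- the deviation bound, with constants that depend only on the data above
    (∃ K ω₁ : ℝ, 0 < ω₁ ∧
      ∀ (A : Plane → ℂ) (φ : Plane → ℝ) (x₀ d₀ : Plane), IsSmoothFront η₀ R C₁ C₂ C₃ A φ x₀ d₀ →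
        ∀ ω : ℝ, ω₁ ≤ ω → ∀ θ : ℝ,
          ‖deltaU A φ x₀ η₀ ω (Cε / √ω) θ‖ ≤ 2 * Cε ^ 2 * C₃ * ‖A x₀‖ + K / √ω) ∧
    -- the noise condition and the error of the ray direction, for small `Cε` and large `ω`
    (2 * Cε ^ 2 * C₃ ≤ 1 / 4 →
      ∃ K : ℝ, ∀ a : ℝ, 0 < a → ∃ ω₂ : ℝ, 0 < ω₂ ∧
        ∀ (A : Plane → ℂ) (φ : Plane → ℝ) (x₀ d₀ : Plane),
          IsSmoothFront η₀ R C₁ C₂ C₃ A φ x₀ d₀ → a ≤ ‖A x₀‖ →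
          ∀ ω : ℝ, ω₂ ≤ ω →
            (∀ B : ℝ, 0 < B → B ≤ 0.89 →
              NoiseCondition B (deltaU A φ x₀ η₀ ω (Cε / √ω)) (planeWave A φ x₀ ω x₀)) ∧
            (∃ θs : ℝ, IsNMLAAngle (ω * η₀) (Cε / √ω) x₀ (waveField A φ ω) θs) ∧
            (∀ θs : ℝ, IsNMLAAngle (ω * η₀) (Cε / √ω) x₀ (waveField A φ ω) θs →
              (∃ θ₁ : ℝ, d₀ = dir θ₁ ∧ |θ₁ - θs| ≤ K / √ω) ∧
              ‖dir θs - d₀‖ ≤ K / √ω)) := by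
  set K := C₁ / η₀ + C₂ * C₃ * Cε / η₀ + 2 * C₁ * Cε with hK
  have hsmall : ∀ ω T : ℝ, 0 ≤ T → T ^ 2 ≤ ω → 1 + 2 * Cε / R ≤ T →
      1 ≤ √ω ∧ Cε / √ω < R := by
    intro ω T hT0 hω hT
    have hs : T ≤ √ω := Real.le_sqrt_of_sq_le hω
    have h1 : 0 < 2 * Cε / R := by positivity
    have hs0 : 0 < √ω := by linarith
    refine ⟨by linarith, ?_⟩
    have h2 : 2 * Cε / R ≤ √ω := by linarith
    rw [div_le_iff₀ hR] at h2
    rw [div_lt_iff₀ hs0]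
    linarith
  have hTR : 0 < 1 + 2 * Cε / R := by positivity
  refine ⟨⟨K, (1 + 2 * Cε / R) ^ 2, by positivity, ?_⟩, ?_⟩
  · intro A φ x₀ d₀ h ω hω θ
    obtain ⟨h1, h2⟩ := hsmall ω _ hTR.le hω le_rfl
    have h3 := h.norm_deltaU_le_of_le hη₀ hCε h1 h2 θ
    -- The deviation estimate has the leading constant Cε²C₃; the factor 2 in the statement is slack
    -- here.
    have h4 : 0 ≤ Cε ^ 2 * C₃ * ‖A x₀‖ :=
      mul_nonneg (mul_nonneg (sq_nonneg _) (h.curvature_nonneg hR)) (norm_nonneg _)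
    linarith
  · intro hC
    refine ⟨8 * Real.pi / (η₀ * Cε), fun a ha => ?_⟩
    set M := 1000 + (1400 * Real.exp 410) ^ 3 with hM
    have hM0 : 0 < (1400 * Real.exp 410) ^ 3 := by positivity
    -- The summands ensure in turn √ω ≥ 1 and r < R, K/√ω ≤ 0.005a, and α ≥ M. The amplitude bound a
    -- enters only this threshold, not the constant of the angle error.
    set T := 1 + 2 * Cε / R + 200 * |K| / a + M / (η₀ * Cε) with hT
    have t1 : 0 ≤ 200 * |K| / a := by positivity
    have t2 : 0 < M / (η₀ * Cε) := by positivity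
    have hT0 : 0 < T := by positivity
    refine ⟨T ^ 2, by positivity, fun A φ x₀ d₀ h hA ω hω => ?_⟩
    obtain ⟨h1, h2⟩ := hsmall ω T hT0.le hω (by linarith)
    have hs : T ≤ √ω := Real.le_sqrt_of_sq_le hω
    have hs0 : 0 < √ω := by linarith
    have hω0 : 0 < ω := Real.sqrt_pos.1 hs0
    have hr0 : 0 < Cε / √ω := by positivity
    obtain ⟨θ₀, hd⟩ := exists_eq_dir h.norm_direction
    have hα : ω * η₀ * (Cε / √ω) = η₀ * Cε * √ω := by
      nth_rewrite 1 [← Real.sq_sqrt hω0.le]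
      field_simp
    have hαM : M ≤ ω * η₀ * (Cε / √ω) := by
      have : M / (η₀ * Cε) ≤ √ω := by linarith
      rw [div_le_iff₀ (by positivity)] at this
      rw [hα]
      linarith
    set b := planeWave A φ x₀ ω x₀ with hb
    have hbA : ‖b‖ = ‖A x₀‖ := norm_planeWave_center A φ x₀ ω
    have hb0 : 0 < ‖b‖ := by rw [hbA]; linarith
    -- The unslackened constant matters: Cε²C₃ ≤ 1/8 gives 1/8 + 0.005 = 0.13, whereas noise of 1/4,
    -- amplified by 3.25, would exceed half the amplitude.
    have hδ : ∀ θ, ‖deltaU A φ x₀ η₀ ω (Cε / √ω) θ‖ ≤ 0.13 * ‖b‖ := by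
      intro θ
      have h3 := h.norm_deltaU_le_of_le hη₀ hCε h1 h2 θ
      have h4 : K / √ω ≤ 0.005 * a := by
        have : 200 * |K| / a ≤ √ω := by linarith
        rw [div_le_iff₀ ha] at this
        rw [div_le_iff₀ hs0]
        linarith [le_abs_self K]
      have h5 : Cε ^ 2 * C₃ * ‖A x₀‖ ≤ 1 / 8 * ‖A x₀‖ :=
        mul_le_mul_of_nonneg_right (by linarith) (norm_nonneg _)
      rw [hbA]
      linarith
    refine ⟨fun B hB hB' => noiseCondition_of_norm_le hb0 hδ hB hB',
      exists_isMax_nmlaFilter _ _, fun θs hmax => ?_⟩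
    obtain ⟨θ₁, hd₁, hθ₁⟩ := exists_abs_sub_le_pi θs θ₀
    rw [hd₁] at hd
    have hplane : ∀ θ, impedance (ω * η₀) (Cε / √ω) x₀ (planeWave A φ x₀ ω) θ
        = b * planeData (ω * η₀ * (Cε / √ω)) θ₁ θ :=
      impedance_planeWave A _ hη₀.ne' hω0.ne' (by rw [h.gradient_phase, hd])
    have hcU := h.continuous_impedance hη₀.ne' hω0.ne' hr0.le h2
    have hcV : Continuous (deltaU A φ x₀ η₀ ω (Cε / √ω)) := by
      have hc := continuous_planeData (ω * η₀ * (Cε / √ω)) θ₁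
      have : deltaU A φ x₀ η₀ ω (Cε / √ω) = fun θ =>
          impedance (ω * η₀) (Cε / √ω) x₀ (waveField A φ ω) θ
            - b * planeData (ω * η₀ * (Cε / √ω)) θ₁ θ :=
        funext fun θ => by rw [deltaU, hplane]
      rw [this]
      fun_prop
    have hU : impedance (ω * η₀) (Cε / √ω) x₀ (waveField A φ ω) = fun θ =>
        b * planeData (ω * η₀ * (Cε / √ω)) θ₁ θ + deltaU A φ x₀ η₀ ω (Cε / √ω) θ :=
      funext fun θ => by rw [deltaU, hplane]; ring
    -- Maximality is used only through comparison with the value at the true direction.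
    have hmax₁ := hmax θ₁
    rw [hU] at hmax₁
    have hsin := abs_sin_le_of_isMax (by linarith) (by linarith) hb0 hcV hδ hmax₁
    rw [abs_sub_comm] at hθ₁
    have hψ := abs_le_of_abs_sin_half_le hθ₁ hsin
    have hfin : |θs - θ₁| ≤ 8 * Real.pi / (η₀ * Cε) / √ω := by
      refine hψ.trans_eq ?_
      rw [hα]
      field_simp
    refine ⟨⟨θ₁, hd, by rwa [abs_sub_comm]⟩, ?_⟩
    rw [hd]
    exact (norm_dir_sub_le θs θ₁).trans hfin
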